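/- Let $X$ be a smooth manifold (Hausdorff, second countable, without boundary) of dimension $n$, and let $E \to X$ be a smooth real vector bundle of finite rank. For an open $U \subseteq X$ let $\mathcal{E}(U)$ be the space of smooth sections of $E$ over $U$. For $m \ge 0$ let $\mathrm{Lag}_c^{[m]}(U) = C^\infty_c(U^m) \otimes_{C^\infty_c(U)^{\otimes m}} \mathrm{Lag}_c(U)^{\otimes m}$ (algebraic tensor products), where $\mathrm{Lag}_c(U)$ is the space of compactly supported Lagrangian densities, spanned by products $\alpha\otimes\mu$ of a smooth function $\alpha$ on the total space of $J^kE|_U$ for some $k \in \mathbb{N}$ (a Lagrangian of order $k$) and a smooth density $\mu$ with compact support in $U$. Let $\mathrm{loc}_c^{\langle m\rangle}(U)$ be the space of functionals $\mathcal{E}(U)\to\mathbb{R}$ that is the image of $\mathrm{Lag}_c^{[m]}(U)$ under the linear map $q^{\langle m\rangle}$ that sends $h \otimes (\alpha_1\otimes\mu_1) \otimes\dots\otimes (\alpha_m\otimes\mu_m)$ to $$\phi \longmapsto \int_{U^m} h(x_1,\dots,x_m)\prod_{i=1}^m \alpha_i\big(\mathrm{j}_{k_i}\phi(x_i)\big)\,\mu_i(x_i),$$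 where $k_i$ is the order of $\alpha_i$ and $\mathrm{j}_{k}\phi$ is the $k$-jet prolongation of $\phi$. Put $\mathrm{Mloc}_c(U) = \bigoplus_{m\ge 0} \mathrm{loc}_c^{\langle m\rangle}(U)$ (external direct sum). Then $\mathrm{Mloc}_c$ is a strict factorization algebra on $X$ with values in real vector spaces (with the algebraic tensor product), with structure maps given by products of functionals. Precisely: (1) There are linear structure maps $\iota_{\{U_i\};V}\colon \bigotimes_{i} \mathrm{Mloc}_c(U_i) \to \mathrm{Mloc}_c(V)$, for every finite (possibly empty) family of pairwise disjoint opens $U_i$ contained in an open $V$, such that for $F_i \in \mathrm{loc}_c^{\langle d_i\rangle}(U_i)$ the element $\iota_{\{U_i\};V}(\bigotimes_i F_i)$ is the functional $\phi \mapsto \prod_i F_i(\phi|_{U_i})$, which lies in $\mathrm{loc}_c^{\langle \sum_i d_i\rangle}(V)$, placed in degree $\sum_i d_i$. These maps form a prefactorization algebra: they are equivariant under relabelling, associative under composition, and the structure map for the single open $U$ in $U$ is the identity. (2) For every open $V$ and every Weiss cover $\{U_i\}_{i\in I}$ of $V$ (a family of opens $U_i \subseteq V$ such that every finite subset of $V$,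 including the empty one, is contained in some $U_i$), the sequence $$\bigoplus_{(j,k)\in I\times I} \mathrm{Mloc}_c(U_j\cap U_k) \longrightarrow \bigoplus_{i\in I} \mathrm{Mloc}_c(U_i) \longrightarrow \mathrm{Mloc}_c(V) \longrightarrow 0$$ is exact, where the second map is the sum of the extension maps (the structure maps for one open in $V$) and the first map sends an element of the $(j,k)$ summand to its extension to $U_j$ minus its extension to $U_k$. -/

import Mathlib

open Set Filter Topology TopologicalSpace MeasureTheory Bundle DirectSum
open scoped Manifold ContDiff

universe w

noncomputable section

namespace Multilocal

/-! ### Prefactorization algebras and strict factorization algebras -/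

section Factorization

variable {X : Type*} [TopologicalSpace X]

/-- The structure of a prefactorization algebra, with values in real vector spaces with the
algebraic tensor product, on a family `A` of vector spaces indexed by the opens of `X`.
For every finite family `U` of pairwise disjoint opens contained in `V` there is a structure map
`⨂ i, A (U i) → A V` (a multilinear map). The structure maps are equivariant under relabelling
and associative on the nose, and the structure map for `U ⊆ U` is the identity.
The empty family gives the unit of `A V`. -/
structure PrefactorizationAlgebra (A : Opens X → Type*) [∀ U, AddCommGroup (A U)]
    [∀ U, Module ℝ (A U)] where
  /-- The structure maps. -/
  str : ∀ {ι : Type} [Finite ι] (U : ι → Opens X) (V : Opens X),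
    (Pairwise fun i j => Disjoint (U i) (U j)) → (∀ i, U i ≤ V) →
      MultilinearMap ℝ (fun i => A (U i)) (A V)
  str_id : ∀ (U : Opens X) (hd : Pairwise fun _ _ : Unit => Disjoint U U) (a : A U),
    str (fun _ : Unit => U) U hd (fun _ => le_rfl) (fun _ => a) = a
  str_reindex : ∀ {ι κ : Type} [Finite ι] [Finite κ] (e : κ ≃ ι) (U : ι → Opens X) (V : Opens X)
    (hd : Pairwise fun i j => Disjoint (U i) (U j))
    (hd' : Pairwise fun i j => Disjoint (U (e i)) (U (e j))) (hV : ∀ i, U i ≤ V)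
    (a : ∀ i, A (U i)),
    str (fun k => U (e k)) V hd' (fun k => hV (e k)) (fun k => a (e k)) = str U V hd hV a
  str_assoc : ∀ {ι : Type} {κ : ι → Type} [Finite ι] [∀ i, Finite (κ i)]
    (U : ∀ i, κ i → Opens X) (W : ι → Opens X) (V : Opens X)
    (hU : ∀ i, Pairwise fun j k => Disjoint (U i j) (U i k)) (hUW : ∀ i j, U i j ≤ W i)
    (hW : Pairwise fun i j => Disjoint (W i) (W j)) (hWV : ∀ i, W i ≤ V)
    (hd : Pairwise fun p q : (Σ i, κ i) => Disjoint (U p.1 p.2) (U q.1 q.2))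
    (a : ∀ i j, A (U i j)),
    str W V hW hWV (fun i => str (U i) (W i) (hU i) (hUW i) (a i)) =
      str (fun p : (Σ i, κ i) => U p.1 p.2) V hd (fun p => (hUW p.1 p.2).trans (hWV p.1))
        (fun p => a p.1 p.2)

/-- A Weiss cover of `V`: a family of opens of `V` such that every finite subset of `V`
is contained in one of them. -/
def IsWeissCover {ι : Type*} (U : ι → Opens X) (V : Opens X) : Prop :=
  (∀ i, U i ≤ V) ∧ ∀ S : Finset X, (∀ x ∈ S, x ∈ V) → ∃ i, ∀ x ∈ S, x ∈ U i

namespace PrefactorizationAlgebra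

variable {A : Opens X → Type*} [∀ U, AddCommGroup (A U)] [∀ U, Module ℝ (A U)]

/-- The extension map `A U → A V` for `U ⊆ V`: the structure map of a one-element family. -/
def ext (P : PrefactorizationAlgebra A) {U V : Opens X} (h : U ≤ V) : A U →ₗ[ℝ] A V where
  toFun a := P.str (fun _ : Unit => U) V Subsingleton.pairwise (fun _ => h) (fun _ => a)
  map_add' a b := by
    have := (P.str (fun _ : Unit => U) V Subsingleton.pairwise (fun _ => h)).map_update_add
      (fun _ => 0) () a b
    have e : ∀ c : A U, Function.update (fun _ : Unit => (0 : A U)) () c = fun _ => c := by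
      intro c; funext u; cases u; simp
    simpa only [e] using this
  map_smul' r a := by
    have := (P.str (fun _ : Unit => U) V Subsingleton.pairwise (fun _ => h)).map_update_smul
      (fun _ => 0) () r a
    have e : ∀ c : A U, Function.update (fun _ : Unit => (0 : A U)) () c = fun _ => c := by
      intro c; funext u; cases u; simp
    simpa only [e, RingHom.id_apply] using this

open scoped Classical in
/-- The map `⨁ i, A (U i) → A V` summing the extensions. -/
def sumExt (P : PrefactorizationAlgebra A) {ι : Type*} (U : ι → Opens X) (V : Opens X)
    (hV : ∀ i, U i ≤ V) : (⨁ i, A (U i)) →ₗ[ℝ] A V :=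
  toModule ℝ ι (A V) fun i => P.ext (hV i)

open scoped Classical in
/-- The map `⨁ (j, k), A (U j ⊓ U k) → ⨁ i, A (U i)` given on the summand `(j, k)` by the
extension to `U j` minus the extension to `U k`. -/
def overlapDiff (P : PrefactorizationAlgebra A) {ι : Type*} (U : ι → Opens X) :
    (⨁ p : ι × ι, A (U p.1 ⊓ U p.2)) →ₗ[ℝ] ⨁ i, A (U i) :=
  toModule ℝ (ι × ι) (⨁ i, A (U i)) fun p =>
    lof ℝ ι (fun i => A (U i)) p.1 ∘ₗ P.ext inf_le_left -
      lof ℝ ι (fun i => A (U i)) p.2 ∘ₗ P.ext inf_le_right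

/-- A strict factorization algebra: a prefactorization algebra that is a (non-homotopical) cosheaf
for Weiss covers, i.e. for every open `V` and every Weiss cover `U` of `V`, the sum of the
extension maps exhibits `A V` as the cokernel of `overlapDiff`. -/
def IsFactorizationAlgebra (P : PrefactorizationAlgebra A) : Prop :=
  ∀ (ι : Type w) (U : ι → Opens X) (V : Opens X) (hU : IsWeissCover U V),
    Function.Exact (P.overlapDiff U) (P.sumExt U V hU.1) ∧
      Function.Surjective (P.sumExt U V hU.1)

end PrefactorizationAlgebra

end Factorization

/-! ### Fields, jets and Lagrangians

`X` is a manifold of dimension `n`, and `E` is a real vector bundle on `X` with model fibre `F`. -/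

section Fields

variable {n : ℕ} {X : Type*} [TopologicalSpace X] [ChartedSpace (EuclideanSpace ℝ (Fin n)) X]
  {F : Type*} [NormedAddCommGroup F] [NormedSpace ℝ F]
  (E : X → Type*) [∀ x, AddCommGroup (E x)] [∀ x, Module ℝ (E x)]
  [∀ x, TopologicalSpace (E x)] [TopologicalSpace (TotalSpace F E)] [FiberBundle F E]
  [VectorBundle ℝ F E]

variable (n F) in
/-- The fields on `U`: smooth sections of `E` over the open submanifold `U`. -/
def FieldOn (U : Opens X) : Type _ :=
  {φ : ∀ x : U, E x // ContMDiff (𝓡 n) ((𝓡 n).prod 𝓘(ℝ, F)) ∞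
    fun x : U => (⟨(x : X), φ x⟩ : TotalSpace F E)}

variable {E} in
/-- Restriction of fields to a smaller open set. -/
def FieldOn.restrict {U V : Opens X} (h : U ≤ V) (φ : FieldOn n F E V) : FieldOn n F E U :=
  ⟨fun x => φ.1 ⟨x, h x.2⟩, φ.2.comp (contMDiff_inclusion h)⟩

variable (n F) in
/-- Sections of `E` near `x`: only the germ at `x` matters; it has to be smooth. -/
def LocalSection (x : X) : Type _ :=
  {s : ∀ y, E y // ∀ᶠ y in 𝓝 x, ContMDiffAt (𝓡 n) ((𝓡 n).prod 𝓘(ℝ, F)) ∞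
    (fun z => (⟨z, s z⟩ : TotalSpace F E)) y}

variable {E} in
variable (n F) in
/-- The expression of a section in the chart of `X` and the trivialization of `E` at `x₀`. -/
def localRep (x₀ : X) (s : ∀ y, E y) (z : EuclideanSpace ℝ (Fin n)) : F :=
  (trivializationAt F E x₀ ⟨(extChartAt (𝓡 n) x₀).symm z, s ((extChartAt (𝓡 n) x₀).symm z)⟩).2

/-- The values of the derivatives of orders `0, …, k` at a point of a map from `ℝⁿ` to `F`. -/
abbrev TaylorData (n : ℕ) (F : Type*) [NormedAddCommGroup F] [NormedSpace ℝ F] (k : ℕ) : Type _ :=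
  ∀ i : Fin (k + 1), EuclideanSpace ℝ (Fin n) [×(i : ℕ)]→L[ℝ] F

variable {E} in
/-- The derivatives up to order `k` at `x`, in the chart and the trivialization at `x₀`. -/
def taylorData (k : ℕ) (x₀ x : X) (s : ∀ y, E y) : TaylorData n F k :=
  fun i => iteratedFDeriv ℝ (i : ℕ) (localRep n F x₀ s) (extChartAt (𝓡 n) x₀ x)

variable (n F) in
/-- Two sections near `x` have the same `k`-jet at `x` if their derivatives at `x` agree up to
order `k` (in local coordinates). -/
def jetSetoid (k : ℕ) (x : X) : Setoid (LocalSection n F E x) :=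
  Setoid.ker fun s => (taylorData k x x s.1 : TaylorData n F k)

variable (n F) in
/-- The fibre at `x` of the jet bundle `Jᵏ E`. -/
def Jet (k : ℕ) (x : X) : Type _ := Quotient (jetSetoid n F E k x)

variable {E} in
open scoped Classical in
/-- Extension by zero of a field on `U`. -/
def FieldOn.extend {U : Opens X} (φ : FieldOn n F E U) : ∀ y, E y :=
  fun y => if h : y ∈ U then φ.1 ⟨y, h⟩ else 0

variable {E} in
set_option linter.unusedSectionVars false in
theorem FieldOn.extend_smooth {U : Opens X} (φ : FieldOn n F E U) {x : X} (hx : x ∈ U) :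
    ∀ᶠ y in 𝓝 x, ContMDiffAt (𝓡 n) ((𝓡 n).prod 𝓘(ℝ, F)) ∞
      (fun z => (⟨z, φ.extend z⟩ : TotalSpace F E)) y := by
  filter_upwards [U.isOpen.mem_nhds hx] with y hy
  refine (contMDiffAt_subtype_iff (U := U) (x := ⟨y, hy⟩)).1 ?_
  have h := φ.2.contMDiffAt (x := (⟨y, hy⟩ : U))
  have e : (fun x : U => (⟨(x : X), φ.extend x⟩ : TotalSpace F E)) =
      fun x : U => (⟨(x : X), φ.1 x⟩ : TotalSpace F E) := by
    funext z
    simp [FieldOn.extend]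
  rw [e]
  exact h

variable (n F) in
/-- The zero section near `x`. -/
def zeroLocalSection (x : X) : LocalSection n F E x :=
  ⟨fun _ => 0, Eventually.of_forall fun _ => Bundle.contMDiff_zeroSection ℝ E _⟩

variable {E} in
open scoped Classical in
/-- The `k`-jet prolongation of a field on `U`, at the points of `U`
(and the zero jet at the other points, where it is never used). -/
def FieldOn.jet (k : ℕ) {U : Opens X} (φ : FieldOn n F E U) (x : X) : Jet n F E k x :=
  Quotient.mk _ (if h : x ∈ U then ⟨φ.extend, φ.extend_smooth h⟩ else zeroLocalSection n F E x)

variable {E} in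
/-- `α` is a Lagrangian of order `k` over `U`, i.e. a smooth function on the total space of `Jᵏ E`
over `U`: in the local coordinates of `Jᵏ E` given by a chart of `X` and a trivialization of `E`
(the base point, and the derivatives up to order `k`), it is given by a smooth function.
The values of `α` over points outside `U` play no role. -/
def IsLagrangian (k : ℕ) (U : Opens X) (α : ∀ x, Jet n F E k x → ℝ) : Prop :=
  ∀ x₀ : X, ∃ a : EuclideanSpace ℝ (Fin n) × TaylorData n F k → ℝ,
    ContDiffOn ℝ ∞ a
      ({z | z ∈ (extChartAt (𝓡 n) x₀).target ∧ (extChartAt (𝓡 n) x₀).symm z ∈ U ∧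
        (extChartAt (𝓡 n) x₀).symm z ∈ (trivializationAt F E x₀).baseSet} ×ˢ univ) ∧
    ∀ x, x ∈ U → x ∈ (extChartAt (𝓡 n) x₀).source → x ∈ (trivializationAt F E x₀).baseSet →
      ∀ s : LocalSection n F E x,
        α x (Quotient.mk _ s) = a (extChartAt (𝓡 n) x₀ x, taylorData k x₀ x s.1)

end Fields

/-! ### Densities -/

section Densities

variable (n : ℕ) {X : Type*} [TopologicalSpace X] [ChartedSpace (EuclideanSpace ℝ (Fin n)) X]
  [MeasurableSpace X]

/-- `ν` is a smooth nonnegative density: in every chart it is a smooth nonnegative function times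
Lebesgue measure. -/
def IsSmoothMeasure (ν : Measure X) : Prop :=
  ∀ x₀ : X, ∃ ρ : EuclideanSpace ℝ (Fin n) → ℝ,
    ContDiffOn ℝ ∞ ρ (extChartAt (𝓡 n) x₀).target ∧
    (∀ z ∈ (extChartAt (𝓡 n) x₀).target, 0 ≤ ρ z) ∧
    (ν.restrict (extChartAt (𝓡 n) x₀).source).map (extChartAt (𝓡 n) x₀) =
      (volume.restrict (extChartAt (𝓡 n) x₀).target).withDensity fun z => ENNReal.ofReal (ρ z)

/-- A (signed) smooth density with compact support in `U`, presented as `coeff • ref` where `ref` is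
a smooth nonnegative density and `coeff` is a smooth function with compact support in `U`.
(Every compactly supported smooth density is of this form, e.g. with `ref` nowhere zero.) -/
structure CompactDensity (U : Opens X) where
  ref : Measure X
  isSmoothMeasure_ref : IsSmoothMeasure n ref
  coeff : X → ℝ
  contMDiff_coeff : ContMDiff (𝓡 n) 𝓘(ℝ) ∞ coeff
  hasCompactSupport_coeff : HasCompactSupport coeff
  tsupport_coeff_subset : tsupport coeff ⊆ U

/-- Smoothness of a function on the product manifold `X^m`, expressed in product charts. -/
def SmoothOnPower {m : ℕ} (h : (Fin m → X) → ℝ) : Prop :=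
  ∀ c : Fin m → X, ContDiffOn ℝ ∞
    (fun z : Fin m → EuclideanSpace ℝ (Fin n) => h fun i => (extChartAt (𝓡 n) (c i)).symm (z i))
    (univ.pi fun i => (extChartAt (𝓡 n) (c i)).target)

end Densities

/-! ### Multilocal functionals -/

section Functionals

variable (n : ℕ) {X : Type*} [TopologicalSpace X] [ChartedSpace (EuclideanSpace ℝ (Fin n)) X]
  [MeasurableSpace X]
  (F : Type*) [NormedAddCommGroup F] [NormedSpace ℝ F]
  (E : X → Type*) [∀ x, AddCommGroup (E x)] [∀ x, Module ℝ (E x)]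
  [∀ x, TopologicalSpace (E x)] [TopologicalSpace (TotalSpace F E)] [FiberBundle F E]
  [VectorBundle ℝ F E]

/-- A decomposable compactly supported Lagrangian density `α ⊗ μ` on `U`: a Lagrangian `α` over `U`
of some finite order, and a smooth density `μ` with compact support in `U`. These span the
compactly supported Lagrangian densities on `U`. -/
structure LagrangianDensity (U : Opens X) where
  order : ℕ
  lagrangian : ∀ x, Jet n F E order x → ℝ
  isLagrangian : IsLagrangian order U lagrangian
  density : CompactDensity n U

/-- A pure tensor `h ⊗ (L₁ ⊗ ⋯ ⊗ Lₘ)` in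
`C^∞_c(U^m) ⊗_{C^∞_c(U)^{⊗m}} (Lag_c(U))^{⊗m}`, the space of compactly supported degree `m`
Lagrangian densities on `U`, with decomposable `Lᵢ`. Such tensors span it. -/
structure MultiLagrangianDensity (m : ℕ) (U : Opens X) where
  weight : (Fin m → X) → ℝ
  smooth_weight : SmoothOnPower n weight
  hasCompactSupport_weight : HasCompactSupport weight
  tsupport_weight_subset : tsupport weight ⊆ {x | ∀ i, x i ∈ U}
  factor : Fin m → LagrangianDensity n F E U

variable {n F E} in
/-- The degree `m` multilocal functional
`φ ↦ ∫_{U^m} h(x₁, …, xₘ) ∏ᵢ αᵢ(jφ(xᵢ)) μᵢ(xᵢ)` on the fields on `U`. -/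
def MultiLagrangianDensity.functional {m : ℕ} {U : Opens X}
    (T : MultiLagrangianDensity n F E m U) (φ : FieldOn n F E U) : ℝ :=
  ∫ x in {x : Fin m → X | ∀ i, x i ∈ U},
    T.weight x * ∏ i, ((T.factor i).lagrangian (x i) (φ.jet (T.factor i).order (x i)) *
      (T.factor i).density.coeff (x i))
    ∂Measure.pi fun i => (T.factor i).density.ref

/-- The space of degree `m` multilocal functionals on `U`: the image, in the functions on the space
of fields on `U`, of the linear map that sends a compactly supported degree `m` Lagrangian density
to its functional; that is, the span of the functionals of pure tensors. -/
def MultiLoc (m : ℕ) (U : Opens X) : Submodule ℝ (FieldOn n F E U → ℝ) :=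
  Submodule.span ℝ (range fun T : MultiLagrangianDensity n F E m U => T.functional)

/-- The space of multilocal functionals on `U`: the (external) direct sum over all degrees. -/
abbrev MLoc (U : Opens X) : Type _ := ⨁ m : ℕ, MultiLoc n F E m U

variable {n F E} in
/-- The structure maps of `P` are given by products of functionals: for `f i` of degree `d i` on
pairwise disjoint `U i ⊆ V`, the structure map sends `⨂ i, f i` to the element of degree `∑ i, d i`
given by the functional `φ ↦ ∏ i, f i (φ|_{U i})` on the fields on `V`. -/
def IsProductStructure (P : PrefactorizationAlgebra fun U : Opens X => MLoc n F E U) : Prop :=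
  ∀ {ι : Type} [Fintype ι] (U : ι → Opens X) (V : Opens X)
    (hd : Pairwise fun i j => Disjoint (U i) (U j)) (hV : ∀ i, U i ≤ V)
    (d : ι → ℕ) (f : ∀ i, MultiLoc n F E (d i) (U i)),
    ∃ g : MultiLoc n F E (∑ i, d i) V,
      (∀ φ : FieldOn n F E V, g.1 φ = ∏ i, (f i).1 (φ.restrict (hV i))) ∧
      P.str U V hd hV (fun i => lof ℝ ℕ (fun m => MultiLoc n F E m (U i)) (d i) (f i)) =
        lof ℝ ℕ (fun m => MultiLoc n F E m V) (∑ i, d i) g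

end Functionals

end Multilocal

end

/-! The prefactorization structure is formal. The multilocal functionals on an open set form a
commutative graded algebra under pointwise products, extension to a larger open set (precomposition
with restriction of fields) is an algebra homomorphism, and a structure map multiplies the
extensions. The content is the cosheaf property, which is proved in each degree $m$ separately.

Let $f$ have degree $m$ and be carried by a compact $K$, and let $\chi_a$ be finitely many smooth
functions with sum $1$ near $K$. Write $\chi_R=\sum_{a\in R}\chi_a$. The integrand of $f$ at a point
of $K^m$ sees the field only near $m$ points of $K$. Hence the alternating sum of $f(\chi_R\phi)$
over $R\subseteq S$ vanishes unless some point of $K^m$ has coordinates meeting every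
$\operatorname{supp}\chi_a$, $a\in S$. Möbius inversion then gives $f(\phi)=\sum_R c_R
f(\chi_R\phi)$, where $c_R$ does not depend on $f$ and is zero unless one point of $K^m$ meets all
supports of $R$ (`MultiLocOn.eq_sum_coeff`). For a Weiss cover, a Lebesgue number of the cover of
$K^m$ by the $U_k^m$ yields $\chi_a$ such that each $\chi_R$ that occurs is supported in a single
$U_k$ (`IsWeissCover.exists_partition`).

Each term $f(\chi_R\phi)$ must then be a functional of degree exactly $m$ on $U_k$. Off
$\operatorname{supp}\chi_R$ the jet of $\chi_R\phi$ is the zero jet, so every factor of the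
integrand splits into a part living near $\operatorname{supp}\chi_R$ and a part independent of
$\phi$. The latter variables are integrated out, which leaves a smooth weight but lowers the degree.
The degree is restored by multiplying with the constant $1$, which is a local functional of degree
$1$ on every nonempty open set (`Presentation.exists_functional_smul_eq`, `one_mem_multiLoc_one`).

This gives surjectivity at once. For exactness in the middle, let $r_i$ be linear maps on the
functionals on $U_i$ that agree on overlaps, and let the extensions of the $f_i$ sum to zero.
Through $U_i\cap U_k$, the map $r_i$ sends $f_i(\chi_R\,\cdot)$ to $r_k(g_i)$ for a functional $g_i$
on $U_k$. The extension of $\sum_i g_i$ to $V$ is zero and extension is injective, so $\sum_i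
r_k(g_i)=0$. If $U_i\cap U_k$ is empty, $f_i(\chi_R\,\cdot)$ is constant, and constants are compared
through a third member of the cover. The universal choice of $r_i$, with values in the cokernel of
the overlap map, gives exactness. -/

namespace Multilocal

noncomputable section

set_option linter.unusedSectionVars false

/-! ### Products of a function with a section, on the level of Taylor data -/

section Derivs

variable {V : Type*} [NormedAddCommGroup V] [NormedSpace ℝ V]
  {F : Type*} [NormedAddCommGroup F] [NormedSpace ℝ F]

variable (V F) in
/-- The values of the derivatives of orders `0, …, k` at a point of a map from `V` to `F`. -/
abbrev Derivs (k : ℕ) : Type _ := ∀ i : Fin (k + 1), V [×(i : ℕ)]→L[ℝ] F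

/-- The derivatives of orders `0, …, k` of `g` at `z`. -/
def derivs (k : ℕ) (g : V → F) (z : V) : Derivs V F k :=
  fun i => iteratedFDeriv ℝ (i : ℕ) g z

theorem contDiffAt_derivs (k : ℕ) {g : V → F} {z : V} (hg : ContDiffAt ℝ ∞ g z) :
    ContDiffAt ℝ ∞ (derivs k g) z := by
  rw [contDiffAt_pi]
  intro i
  exact hg.iteratedFDeriv_right (by exact_mod_cast le_top)

theorem derivs_congr (k : ℕ) {g g' : V → F} {z : V} (h : g =ᶠ[𝓝 z] g') :
    derivs k g z = derivs k g' z := by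
  funext i
  exact (h.iteratedFDeriv ℝ (i : ℕ)).eq_of_nhds

theorem contDiff_proj {ι : Type*} [Fintype ι] {G : ι → Type*} [∀ i, NormedAddCommGroup (G i)]
    [∀ i, NormedSpace ℝ (G i)] (i : ι) : ContDiff ℝ ∞ fun t : ∀ i, G i => t i :=
  (ContinuousLinearMap.proj (R := ℝ) (φ := G) i).contDiff

/-- The derivative of `derivs i g` in terms of `derivs (i + 1) g`. -/
def derivsFDeriv (i : ℕ) (t : Derivs V F (i + 1)) : V →L[ℝ] Derivs V F i :=
  ContinuousLinearMap.pi fun j => (t j.succ).curryLeft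

theorem hasFDerivAt_derivs (i : ℕ) {g : V → F} {z : V} (hg : ContDiffAt ℝ ∞ g z) :
    HasFDerivAt (derivs i g) (derivsFDeriv i (derivs (i + 1) g z)) z := by
  refine hasFDerivAt_pi'' fun j => ?_
  have h1 : DifferentiableAt ℝ (iteratedFDeriv ℝ (j : ℕ) g) z :=
    (hg.iteratedFDeriv_right (m := 1) (i := (j : ℕ))
      (by exact_mod_cast le_top)).differentiableAt one_ne_zero
  have h2 := h1.hasFDerivAt
  rw [fderiv_iteratedFDeriv] at h2
  exact h2

variable [FiniteDimensional ℝ V]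

theorem contDiff_derivsFDeriv (i : ℕ) : ContDiff ℝ ∞ (derivsFDeriv (V := V) (F := F) i) := by
  rw [contDiff_clm_apply_iff]
  intro y
  rw [contDiff_pi]
  intro j
  have h : ContDiff ℝ ∞ fun t : Derivs V F (i + 1) =>
      continuousMultilinearCurryLeftEquiv ℝ (fun _ : Fin ((j : ℕ) + 1) => V) F (t j.succ) :=
    (LinearIsometryEquiv.contDiff _).comp (contDiff_proj j.succ)
  exact h.clm_apply contDiff_const

-- No explicit Leibniz formula is needed: differentiating $b(z, j_i g(z))$ by the chain rule
-- expresses the next derivative smoothly through $z$ and the derivatives of $g$ up to order $i+1$.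
-- It matters that one $b$ serves all $g$.
set_option synthInstance.maxHeartbeats 100000 in
theorem exists_iteratedFDeriv_smul_eq {f : V → ℝ} {O : Set V} (hO : IsOpen O)
    (hf : ContDiffOn ℝ ∞ f O) (i : ℕ) :
    ∃ b : V × Derivs V F i → V [×i]→L[ℝ] F,
      ContDiffOn ℝ ∞ b (O ×ˢ univ) ∧
      ∀ z ∈ O, ∀ g : V → F, (∀ᶠ y in 𝓝 z, ContDiffAt ℝ ∞ g y) →
        iteratedFDeriv ℝ i (fun y => f y • g y) z = b (z, derivs i g z) := by
  induction i with
  | zero =>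
    refine ⟨fun p => f p.1 • p.2 0, ?_, ?_⟩
    · exact ContDiffOn.smul (hf.comp contDiffOn_fst fun p hp => hp.1)
        ((contDiff_proj 0).comp contDiff_snd).contDiffOn
    · intro z _ g _
      ext m
      simp [derivs]
  | succ i ih =>
    obtain ⟨b, hb, hbg⟩ := ih
    have hO' : IsOpen (O ×ˢ (univ : Set (Derivs V F i))) := hO.prod isOpen_univ
    -- Truncation: $c$ forgets the top derivative. The new $b$ is $Db$ at the truncated data,
    -- applied to the derivative of $z\mapsto(z, j_i g(z))$, which is linear in the untruncated
    -- data.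
    let c : Derivs V F (i + 1) → Derivs V F i := fun t j => t j.castSucc
    have hc : ContDiff ℝ ∞ c := contDiff_pi.2 fun j => contDiff_proj j.castSucc
    refine ⟨fun p => (continuousMultilinearCurryLeftEquiv ℝ (fun _ : Fin (i + 1) => V) F).symm
      (fderiv ℝ b (p.1, c p.2) ∘L (ContinuousLinearMap.id ℝ _).prod (derivsFDeriv i p.2)), ?_, ?_⟩
    · have hin : ContDiffOn ℝ ∞ (fun p : V × Derivs V F (i + 1) => fderiv ℝ b (p.1, c p.2) ∘L
          (ContinuousLinearMap.id ℝ _).prod (derivsFDeriv i p.2)) (O ×ˢ univ) := by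
        refine ContDiffOn.clm_comp ?_ ?_
        · refine (hb.fderiv_of_isOpen (m := ∞) hO' (by simp)).comp
            (contDiffOn_fst.prodMk (hc.comp contDiff_snd).contDiffOn) ?_
          exact fun p hp => ⟨hp.1, mem_univ _⟩
        · refine ContDiff.contDiffOn (contDiff_clm_apply_iff.2 fun y => ?_)
          exact contDiff_const.prodMk
            (((contDiff_derivsFDeriv i).comp contDiff_snd).clm_apply contDiff_const)
      exact (continuousMultilinearCurryLeftEquiv ℝ (fun _ : Fin (i + 1) =>
        V) F).symm.toContinuousLinearEquiv.contDiff.comp_contDiffOn hin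
    · intro z hz g hg
      rw [iteratedFDeriv_succ_eq_comp_left]
      have hev : iteratedFDeriv ℝ i (fun y => f y • g y) =ᶠ[𝓝 z] fun y => b (y, derivs i g y) := by
        filter_upwards [hO.mem_nhds hz, hg.eventually_nhds] with y hy hgy
        exact hbg y hy g hgy
      simp only [Function.comp_apply]
      rw [hev.fderiv_eq]
      congr 1
      have hbz : DifferentiableAt ℝ b (z, derivs i g z) :=
        ((hb.contDiffAt (hO'.mem_nhds ⟨hz, mem_univ _⟩)).differentiableAt (by simp))
      exact (HasFDerivAt.comp z hbz.hasFDerivAt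
        ((hasFDerivAt_id z).prodMk (hasFDerivAt_derivs i hg.self_of_nhds))).fderiv

/-- The Leibniz rule: the derivatives of `f • g` at `z` are a smooth function of `z` and of the
derivatives of `g` at `z`. -/
theorem exists_derivs_smul_eq {f : V → ℝ} {O : Set V} (hO : IsOpen O)
    (hf : ContDiffOn ℝ ∞ f O) (k : ℕ) :
    ∃ b : V × Derivs V F k → Derivs V F k,
      ContDiffOn ℝ ∞ b (O ×ˢ univ) ∧
      ∀ z ∈ O, ∀ g : V → F, (∀ᶠ y in 𝓝 z, ContDiffAt ℝ ∞ g y) →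
        derivs k (fun y => f y • g y) z = b (z, derivs k g z) := by
  choose b hb hbg using exists_iteratedFDeriv_smul_eq (F := F) hO hf
  refine ⟨fun p i => b i (p.1, fun j => p.2 (Fin.castLE i.2 j)), ?_, ?_⟩
  · rw [contDiffOn_pi]
    intro i
    refine (hb i).comp (contDiffOn_fst.prodMk (ContDiff.contDiffOn ?_)) fun p hp => ⟨hp.1, mem_univ _⟩
    rw [contDiff_pi]
    intro j
    exact (contDiff_proj (G := fun i : Fin (k + 1) => V [×(i : ℕ)]→L[ℝ] F)
      (Fin.castLE i.2 j)).comp contDiff_snd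
  · intro z hz g hg
    funext i
    exact hbg i z hz g hg

end Derivs

/-! ### Smooth dependence of integrals on parameters -/

section Parametric

variable {Z E' Y : Type*} [NormedAddCommGroup Z] [NormedSpace ℝ Z]
  [NormedAddCommGroup E'] [NormedSpace ℝ E'] [TopologicalSpace Y]

variable (E') in
/-- `G z y` is smooth in `z ∈ s` and in `y`, the latter in suitable local coordinates on `Y`. -/
def LocallySmooth {W : Type*} [NormedAddCommGroup W] [NormedSpace ℝ W] (s : Set Z)
    (G : Z → Y → W) : Prop :=
  ∀ y₀ : Y, ∃ (c : Y → E') (N : Set Y) (O : Set E') (g : Z × E' → W), IsOpen N ∧ y₀ ∈ N ∧ IsOpen O ∧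
    ContinuousOn c N ∧ MapsTo c N O ∧ ContDiffOn ℝ ∞ g (s ×ˢ O) ∧
    ∀ z ∈ s, ∀ y ∈ N, G z y = g (z, c y)

variable {W : Type*} [NormedAddCommGroup W] [NormedSpace ℝ W] {s : Set Z} {G : Z → Y → W}

theorem LocallySmooth.continuousOn (hG : LocallySmooth E' s G) :
    ContinuousOn (Function.uncurry G) (s ×ˢ univ) := by
  rintro ⟨z, y⟩ ⟨hz, -⟩
  obtain ⟨c, N, O, g, hN, hy, hO, hc, hcm, hg, hGg⟩ := hG y
  have h1 : ContinuousOn (fun p : Z × Y => g (p.1, c p.2)) (s ×ˢ N) :=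
    hg.continuousOn.comp (continuousOn_fst.prodMk (hc.comp continuousOn_snd fun p hp => hp.2))
      fun p hp => ⟨hp.1, hcm hp.2⟩
  have h2 : ContinuousOn (Function.uncurry G) (s ×ˢ N) :=
    h1.congr fun p hp => hGg p.1 hp.1 p.2 hp.2
  refine (h2 (z, y) ⟨hz, hy⟩).mono_of_mem_nhdsWithin ?_
  rw [nhdsWithin_prod_eq, nhdsWithin_univ]
  exact prod_mem_prod self_mem_nhdsWithin (hN.mem_nhds hy)

theorem LocallySmooth.contDiffOn (hG : LocallySmooth E' s G) (y : Y) :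
    ContDiffOn ℝ ∞ (fun z => G z y) s := by
  obtain ⟨c, N, O, g, hN, hy, hO, hc, hcm, hg, hGg⟩ := hG y
  exact (hg.comp (contDiffOn_id.prodMk contDiffOn_const) fun z hz => ⟨hz, hcm hy⟩).congr
    fun z hz => hGg z hz y hy

/-- Stability under differentiation in the parameter; this is what lets differentiation under the
integral be iterated. -/
theorem LocallySmooth.fderiv_left (hs : IsOpen s) (hG : LocallySmooth E' s G) :
    LocallySmooth E' s fun z y => fderiv ℝ (fun z => G z y) z := by
  intro y
  obtain ⟨c, N, O, g, hN, hy, hO, hc, hcm, hg, hGg⟩ := hG y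
  refine ⟨c, N, O, fun p => fderiv ℝ g p ∘L ContinuousLinearMap.inl ℝ Z E', hN, hy, hO, hc, hcm,
    (hg.fderiv_of_isOpen (m := ∞) (hs.prod hO) (by simp)).clm_comp contDiffOn_const, ?_⟩
  intro z hz y hy
  have h1 : (fun z => G z y) =ᶠ[𝓝 z] fun z => g (z, c y) := by
    filter_upwards [hs.mem_nhds hz] with w hw using hGg w hw y hy
  beta_reduce
  rw [h1.fderiv_eq]
  have h2 : DifferentiableAt ℝ g (z, c y) :=
    (hg.contDiffAt ((hs.prod hO).mem_nhds ⟨hz, hcm hy⟩)).differentiableAt (by simp)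
  exact (h2.hasFDerivAt.comp z (hasFDerivAt_prodMk_left z (c y))).fderiv

variable [MeasurableSpace Y] [OpensMeasurableSpace Y] [T2Space Y]
  {ν : Measure Y} [IsFiniteMeasureOnCompacts ν] {K : Set Y}

theorem LocallySmooth.integrable (hK : IsCompact K) (hG : LocallySmooth E' s G)
    (h0 : ∀ z ∈ s, ∀ y ∉ K, G z y = 0) {z : Z} (hz : z ∈ s) : Integrable (G z) ν := by
  have hc : Continuous (G z) := by
    rw [← continuousOn_univ]
    exact hG.continuousOn.comp (continuousOn_const.prodMk continuousOn_id) fun y _ => ⟨hz, mem_univ _⟩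
  exact hc.integrable_of_hasCompactSupport (HasCompactSupport.intro hK (h0 z hz))

/-- Dominated differentiation: the parameter derivative is continuous, hence bounded on a closed
ball times $K$, and it vanishes off $K$. The bound is a constant on $K$, which is integrable since
$K$ has finite measure. -/
theorem LocallySmooth.hasFDerivAt_integral [FiniteDimensional ℝ Z] [CompleteSpace W]
    (hs : IsOpen s) (hK : IsCompact K)
    (hG : LocallySmooth E' s G) (h0 : ∀ z ∈ s, ∀ y ∉ K, G z y = 0) {z₀ : Z} (hz : z₀ ∈ s) :
    HasFDerivAt (fun z => ∫ y, G z y ∂ν) (∫ y, fderiv ℝ (fun z => G z y) z₀ ∂ν) z₀ := by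
  have hD := hG.fderiv_left hs
  have hD0 : ∀ z ∈ s, ∀ y ∉ K, fderiv ℝ (fun z => G z y) z = 0 := by
    intro z hz y hy
    have h1 : (fun z => G z y) =ᶠ[𝓝 z] fun _ => 0 := by
      filter_upwards [hs.mem_nhds hz] with w hw using h0 w hw y hy
    rw [h1.fderiv_eq]; simp
  obtain ⟨ε, hε, hεs⟩ := Metric.nhds_basis_closedBall.mem_iff.1 (hs.mem_nhds hz)
  have : ProperSpace Z := FiniteDimensional.proper ℝ Z
  obtain ⟨C, hC⟩ := ((isCompact_closedBall z₀ ε).prod hK).exists_bound_of_continuousOn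
    (hD.continuousOn.mono (prod_mono hεs (subset_univ K)))
  refine hasFDerivAt_integral_of_dominated_of_fderiv_le (s := Metric.closedBall z₀ ε)
    (F := G) (F' := fun z y => fderiv ℝ (fun z => G z y) z)
    (bound := K.indicator fun _ => C) (Metric.closedBall_mem_nhds z₀ hε) ?_
    (hG.integrable hK h0 hz) (hD.integrable hK hD0 hz).aestronglyMeasurable ?_ ?_ ?_
  · filter_upwards [hs.mem_nhds hz] with z hz
    exact (hG.integrable hK h0 hz).aestronglyMeasurable
  · refine Eventually.of_forall fun y z hz => ?_
    by_cases hy : y ∈ K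
    · rw [indicator_of_mem hy]
      exact hC (z, y) ⟨hz, hy⟩
    · rw [indicator_of_notMem hy, hD0 z (hεs hz) y hy, norm_zero]
  · exact (integrable_indicator_iff hK.measurableSet).2
      (integrableOn_const hK.measure_lt_top.ne)
  · refine Eventually.of_forall fun y z hz => ?_
    exact (((hG.contDiffOn y).contDiffAt (hs.mem_nhds (hεs hz))).differentiableAt
      (by simp)).hasFDerivAt

end Parametric

/-- Induction on the order of differentiability: the derivative of the integral is again such an
integral, with values in $Z\to W$. The target therefore varies in the induction, and putting `Z` and
`W` in one universe keeps it in the same universe. -/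
theorem LocallySmooth.contDiffOn_integral {Z W : Type} {E' Y : Type*} [NormedAddCommGroup Z]
    [NormedSpace ℝ Z] [FiniteDimensional ℝ Z] [NormedAddCommGroup E'] [NormedSpace ℝ E']
    [NormedAddCommGroup W] [NormedSpace ℝ W] [CompleteSpace W]
    [TopologicalSpace Y] [MeasurableSpace Y] [OpensMeasurableSpace Y] [T2Space Y]
    {ν : Measure Y} [IsFiniteMeasureOnCompacts ν] {s : Set Z} (hs : IsOpen s) {K : Set Y}
    (hK : IsCompact K) {G : Z → Y → W} (hG : LocallySmooth E' s G)
    (h0 : ∀ z ∈ s, ∀ y ∉ K, G z y = 0) :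
    ContDiffOn ℝ ∞ (fun z => ∫ y, G z y ∂ν) s := by
  rw [contDiffOn_infty]
  intro k
  induction k generalizing W with
  | zero =>
    refine contDiffOn_zero.2 fun z hz => ?_
    exact (hG.hasFDerivAt_integral hs hK h0 hz).continuousAt.continuousWithinAt
  | succ k ih =>
    have hd : ∀ z ∈ s, HasFDerivAt (fun z => ∫ y, G z y ∂ν)
        (∫ y, fderiv ℝ (fun z => G z y) z ∂ν) z :=
      fun z hz => hG.hasFDerivAt_integral hs hK h0 hz
    push_cast
    rw [contDiffOn_succ_iff_fderiv_of_isOpen hs]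
    refine ⟨fun z hz => (hd z hz).differentiableAt.differentiableWithinAt, by simp, ?_⟩
    refine (ih (hG.fderiv_left hs) fun z hz y hy => ?_).congr fun z hz => (hd z hz).fderiv
    have h1 : (fun z => G z y) =ᶠ[𝓝 z] fun _ => 0 := by
      filter_upwards [hs.mem_nhds hz] with w hw using h0 w hw y hy
    rw [h1.fderiv_eq]; simp

/-! ### Jets of products of functions with sections -/

section Jets

variable {n : ℕ} {X : Type*} [TopologicalSpace X] [ChartedSpace (EuclideanSpace ℝ (Fin n)) X]
  {F : Type*} [NormedAddCommGroup F] [NormedSpace ℝ F]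
  {E : X → Type*} [∀ x, AddCommGroup (E x)] [∀ x, Module ℝ (E x)]
  [∀ x, TopologicalSpace (E x)] [TopologicalSpace (TotalSpace F E)] [FiberBundle F E]
  [VectorBundle ℝ F E]

variable (n F) in
/-- Smoothness of a section of `E` at a point. -/
abbrev SmoothSectionAt (s : ∀ y, E y) (x : X) : Prop :=
  ContMDiffAt (𝓡 n) ((𝓡 n).prod 𝓘(ℝ, F)) ∞ (fun z => (⟨z, s z⟩ : TotalSpace F E)) x

variable (F E) in
/-- The points of the chart at `x₀` over which `E` is trivialized. -/
def chartRegion (x₀ : X) : Set (EuclideanSpace ℝ (Fin n)) :=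
  {z | z ∈ (extChartAt (𝓡 n) x₀).target ∧
    (extChartAt (𝓡 n) x₀).symm z ∈ (trivializationAt F E x₀).baseSet}

variable (n) in
theorem isOpen_target_inter_preimage (x₀ : X) {O : Set X} (hO : IsOpen O) :
    IsOpen {z | z ∈ (extChartAt (𝓡 n) x₀).target ∧ (extChartAt (𝓡 n) x₀).symm z ∈ O} :=
  (continuousOn_extChartAt_symm x₀).isOpen_inter_preimage (isOpen_extChartAt_target x₀) hO

theorem isOpen_chartRegion (x₀ : X) : IsOpen (chartRegion (n := n) F E x₀) :=
  isOpen_target_inter_preimage n x₀ (trivializationAt F E x₀).open_baseSet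

theorem mem_chartRegion {x₀ x : X} (hx : x ∈ (extChartAt (𝓡 n) x₀).source)
    (hb : x ∈ (trivializationAt F E x₀).baseSet) :
    extChartAt (𝓡 n) x₀ x ∈ chartRegion (n := n) F E x₀ :=
  ⟨(extChartAt (𝓡 n) x₀).map_source hx, by rwa [(extChartAt (𝓡 n) x₀).left_inv hx]⟩

theorem eventually_chart {x₀ x : X} (hx : x ∈ (extChartAt (𝓡 n) x₀).source) {p : X → Prop}
    (hp : ∀ᶠ y in 𝓝 x, p y) :
    ∀ᶠ z in 𝓝 (extChartAt (𝓡 n) x₀ x), p ((extChartAt (𝓡 n) x₀).symm z) := by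
  have h : ContinuousAt (extChartAt (𝓡 n) x₀).symm (extChartAt (𝓡 n) x₀ x) :=
    continuousAt_extChartAt_symm' hx
  have h' := h.tendsto
  rw [(extChartAt (𝓡 n) x₀).left_inv hx] at h'
  exact h'.eventually hp

theorem localRep_congr {x₀ x : X} (hx : x ∈ (extChartAt (𝓡 n) x₀).source) {s t : ∀ y, E y}
    (h : ∀ᶠ y in 𝓝 x, s y = t y) :
    localRep n F x₀ s =ᶠ[𝓝 (extChartAt (𝓡 n) x₀ x)] localRep n F x₀ t := by
  filter_upwards [eventually_chart hx h] with z hz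
  simp only [localRep, hz]

theorem taylorData_congr (k : ℕ) {x₀ x : X} (hx : x ∈ (extChartAt (𝓡 n) x₀).source)
    {s t : ∀ y, E y} (h : ∀ᶠ y in 𝓝 x, s y = t y) :
    (taylorData k x₀ x s : TaylorData n F k) = taylorData k x₀ x t :=
  derivs_congr k (localRep_congr hx h)

theorem localRep_smul (χ : X → ℝ) {x₀ : X} {z : EuclideanSpace ℝ (Fin n)}
    (hz : z ∈ chartRegion F E x₀) (s : ∀ y, E y) :
    localRep n F x₀ (fun y => χ y • s y) z =
      χ ((extChartAt (𝓡 n) x₀).symm z) • localRep n F x₀ s z :=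
  ((trivializationAt F E x₀).linear ℝ hz.2).2 _ _

theorem jet_mk_congr (k : ℕ) {x : X} {s t : LocalSection n F E x}
    (h : ∀ᶠ y in 𝓝 x, s.1 y = t.1 y) :
    (Quotient.mk _ s : Jet n F E k x) = Quotient.mk _ t :=
  Quotient.sound (taylorData_congr k (mem_extChartAt_source x) h)

variable [IsManifold (𝓡 n) ∞ X]

theorem contDiffOn_comp_extChartAt_symm {χ : X → ℝ} (hχ : ContMDiff (𝓡 n) 𝓘(ℝ) ∞ χ) (x₀ : X) :
    ContDiffOn ℝ ∞ (fun z => χ ((extChartAt (𝓡 n) x₀).symm z)) (extChartAt (𝓡 n) x₀).target := by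
  rw [← contMDiffOn_iff_contDiffOn]
  exact hχ.comp_contMDiffOn (contMDiffOn_extChartAt_symm x₀)

variable [ContMDiffVectorBundle ∞ F E (𝓡 n)]

theorem contDiffAt_localRep {x₀ x : X} (hx : x ∈ (extChartAt (𝓡 n) x₀).source)
    (hb : x ∈ (trivializationAt F E x₀).baseSet) {s : ∀ y, E y} (hs : SmoothSectionAt n F s x) :
    ContDiffAt ℝ ∞ (localRep n F x₀ s) (extChartAt (𝓡 n) x₀ x) := by
  have h1 := ((trivializationAt F E x₀).contMDiffAt_section_iff (IB := 𝓡 n) hb).1 hs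
  have h2 : ContMDiffAt 𝓘(ℝ, EuclideanSpace ℝ (Fin n)) (𝓡 n) ∞ (extChartAt (𝓡 n) x₀).symm
      (extChartAt (𝓡 n) x₀ x) :=
    (contMDiffOn_extChartAt_symm x₀).contMDiffAt
      ((isOpen_extChartAt_target x₀).mem_nhds ((extChartAt (𝓡 n) x₀).map_source hx))
  have h3 : ContMDiffAt (𝓡 n) 𝓘(ℝ, F) ∞ (fun y => (trivializationAt F E x₀ ⟨y, s y⟩).2)
      ((extChartAt (𝓡 n) x₀).symm (extChartAt (𝓡 n) x₀ x)) := by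
    rwa [(extChartAt (𝓡 n) x₀).left_inv hx]
  exact contMDiffAt_iff_contDiffAt.1 (h3.comp _ h2)

theorem eventually_contDiffAt_localRep {x₀ x : X} (hx : x ∈ (extChartAt (𝓡 n) x₀).source)
    (hb : x ∈ (trivializationAt F E x₀).baseSet) {s : ∀ y, E y}
    (hs : ∀ᶠ y in 𝓝 x, SmoothSectionAt n F s y) :
    ∀ᶠ z in 𝓝 (extChartAt (𝓡 n) x₀ x), ContDiffAt ℝ ∞ (localRep n F x₀ s) z := by
  filter_upwards [eventually_chart hx hs, (isOpen_chartRegion x₀).mem_nhds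
    (mem_chartRegion hx hb)] with z hz hz'
  have := contDiffAt_localRep ((extChartAt (𝓡 n) x₀).map_target hz'.1) hz'.2 hz
  rwa [(extChartAt (𝓡 n) x₀).right_inv hz'.1] at this

/-- The Leibniz rule in charts. It yields both that multiplication by $\chi$ descends to jets and
that it acts on them smoothly. -/
theorem exists_taylorData_smul_eq {χ : X → ℝ} (hχ : ContMDiff (𝓡 n) 𝓘(ℝ) ∞ χ) (k : ℕ) (x₀ : X) :
    ∃ b : EuclideanSpace ℝ (Fin n) × TaylorData n F k → TaylorData n F k,
      ContDiffOn ℝ ∞ b (chartRegion F E x₀ ×ˢ univ) ∧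
      ∀ x ∈ (extChartAt (𝓡 n) x₀).source, x ∈ (trivializationAt F E x₀).baseSet →
        ∀ s : ∀ y, E y, (∀ᶠ y in 𝓝 x, SmoothSectionAt n F s y) →
        taylorData k x₀ x (fun y => χ y • s y) =
          b (extChartAt (𝓡 n) x₀ x, taylorData k x₀ x s) := by
  obtain ⟨b, hb, hbs⟩ := exists_derivs_smul_eq (F := F) (isOpen_chartRegion (F := F) (E := E) x₀)
    ((contDiffOn_comp_extChartAt_symm hχ x₀).mono fun z hz => hz.1) k
  refine ⟨b, hb, fun x hx hxb s hs => ?_⟩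
  rw [show (taylorData k x₀ x s : TaylorData n F k) =
    derivs k (localRep n F x₀ s) (extChartAt (𝓡 n) x₀ x) from rfl, ← hbs _ (mem_chartRegion hx hxb)
    _ (eventually_contDiffAt_localRep hx hxb hs)]
  refine derivs_congr k ?_
  filter_upwards [(isOpen_chartRegion x₀).mem_nhds (mem_chartRegion hx hxb)] with z hz
  exact localRep_smul χ hz s

/-- Product of a function and a section near `x`. -/
def LocalSection.smul {χ : X → ℝ} (hχ : ContMDiff (𝓡 n) 𝓘(ℝ) ∞ χ) {x : X}
    (s : LocalSection n F E x) : LocalSection n F E x :=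
  ⟨fun y => χ y • s.1 y, s.2.mono fun y hy => (hχ y).smul_section hy⟩

/-- Product of a function and a jet. -/
def Jet.smul {χ : X → ℝ} (hχ : ContMDiff (𝓡 n) 𝓘(ℝ) ∞ χ) (k : ℕ) (x : X) :
    Jet n F E k x → Jet n F E k x :=
  Quotient.map (LocalSection.smul hχ) fun s t hst => by
    obtain ⟨b, -, hb⟩ := exists_taylorData_smul_eq (F := F) (E := E) hχ k x
    have h : ∀ u : LocalSection n F E x, taylorData k x x (LocalSection.smul hχ u).1 =
        b (extChartAt (𝓡 n) x x, taylorData k x x u.1) := fun u =>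
      hb x (mem_extChartAt_source x) (FiberBundle.mem_baseSet_trivializationAt' x) u.1 u.2
    change (taylorData k x x _ : TaylorData n F k) = taylorData k x x _
    rw [h, h, show (taylorData k x x s.1 : TaylorData n F k) = taylorData k x x t.1 from hst]

/-- Precomposition of a Lagrangian with the multiplication of sections by a function. -/
theorem IsLagrangian.comp_smul {k : ℕ} {U : Opens X} {α : ∀ x, Jet n F E k x → ℝ}
    (hα : IsLagrangian k U α) {χ : X → ℝ} (hχ : ContMDiff (𝓡 n) 𝓘(ℝ) ∞ χ) :
    IsLagrangian k U fun x j => α x (Jet.smul hχ k x j) := by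
  intro x₀
  obtain ⟨a, ha, hax⟩ := hα x₀
  obtain ⟨b, hb, hbs⟩ := exists_taylorData_smul_eq (F := F) (E := E) hχ k x₀
  refine ⟨fun p => a (p.1, b p), ?_, fun x hxU hx hxb s => ?_⟩
  · refine ha.comp (contDiffOn_fst.prodMk (hb.mono ?_)) fun p hp => ⟨hp.1, mem_univ _⟩
    exact fun p hp => ⟨⟨hp.1.1, hp.1.2.2⟩, mem_univ _⟩
  · refine (hax x hxU hx hxb (LocalSection.smul hχ s)).trans ?_
    exact congrArg (fun t => a (extChartAt (𝓡 n) x₀ x, t)) (hbs x hx hxb s.1 s.2)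

/-- The product of a Lagrangian over `U` with a function supported in `U` is a Lagrangian over
every open set. -/
theorem IsLagrangian.mul_of_tsupport_subset {k : ℕ} {U V : Opens X}
    {α : ∀ x, Jet n F E k x → ℝ} (hα : IsLagrangian k U α) {ψ : X → ℝ}
    (hψ : ContMDiff (𝓡 n) 𝓘(ℝ) ∞ ψ) (hψU : tsupport ψ ⊆ U) :
    IsLagrangian k V fun x j => ψ x * α x j := by
  intro x₀
  obtain ⟨a, ha, hax⟩ := hα x₀
  refine ⟨fun p => ψ ((extChartAt (𝓡 n) x₀).symm p.1) * a p, ?_, fun x hxV hx hxb s => ?_⟩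
  · rintro ⟨z, t⟩ ⟨⟨hz, -, hzb⟩, -⟩
    refine ContDiffAt.contDiffWithinAt ?_
    by_cases hzU : (extChartAt (𝓡 n) x₀).symm z ∈ U
    · have hO : IsOpen {z | z ∈ (extChartAt (𝓡 n) x₀).target ∧ (extChartAt (𝓡 n) x₀).symm z ∈ U ∧
          (extChartAt (𝓡 n) x₀).symm z ∈ (trivializationAt F E x₀).baseSet} :=
        isOpen_target_inter_preimage n x₀ (U.isOpen.inter (trivializationAt F E x₀).open_baseSet)
      refine ContDiffAt.mul ?_ (ha.contDiffAt ((hO.prod isOpen_univ).mem_nhds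
        ⟨⟨hz, hzU, hzb⟩, mem_univ _⟩))
      exact ((contDiffOn_comp_extChartAt_symm hψ x₀).contDiffAt
        ((isOpen_extChartAt_target x₀).mem_nhds hz)).comp (z, t) contDiffAt_fst
    -- Here $a$ need not be smooth, but the base point lies outside the closed support of $\psi$, so
    -- the product vanishes nearby.
    · have hO := isOpen_target_inter_preimage n x₀ (isClosed_tsupport ψ).isOpen_compl
      have h0 : (fun p : EuclideanSpace ℝ (Fin n) × TaylorData n F k =>
          ψ ((extChartAt (𝓡 n) x₀).symm p.1) * a p) =ᶠ[𝓝 (z, t)] fun _ => 0 := by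
        filter_upwards [(hO.prod isOpen_univ).mem_nhds
          (mk_mem_prod ⟨hz, fun h => hzU (hψU h)⟩ (mem_univ t))] with p hp
        rw [image_eq_zero_of_notMem_tsupport hp.1.2, zero_mul]
      exact contDiffAt_const.congr_of_eventuallyEq h0
  · beta_reduce
    simp only [(extChartAt (𝓡 n) x₀).left_inv hx]
    by_cases hxU : x ∈ U
    · exact congrArg (ψ x * ·) (hax x hxU hx hxb s)
    · simp only [image_eq_zero_of_notMem_tsupport fun h => hxU (hψU h), zero_mul]

theorem IsLagrangian.mono {k : ℕ} {U V : Opens X} (h : U ≤ V)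
    {α : ∀ x, Jet n F E k x → ℝ} (hα : IsLagrangian k V α) : IsLagrangian k U α := by
  intro x₀
  obtain ⟨a, ha, hax⟩ := hα x₀
  exact ⟨a, ha.mono (prod_mono (fun z hz => ⟨hz.1, h hz.2.1, hz.2.2⟩) subset_rfl),
    fun x hx => hax x (h hx)⟩

theorem isLagrangian_const (k : ℕ) (U : Opens X) (c : ℝ) :
    IsLagrangian k U fun x (_ : Jet n F E k x) => c :=
  fun _ => ⟨fun _ => c, contDiffOn_const, fun _ _ _ _ _ => rfl⟩

/-! ### Operations on fields -/

theorem contMDiff_restrict_section {U : Opens X} {s : ∀ y, E y}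
    (hs : ∀ x ∈ U, SmoothSectionAt n F s x) :
    ContMDiff (𝓡 n) ((𝓡 n).prod 𝓘(ℝ, F)) ∞
      fun x : U => (⟨(x : X), s x⟩ : TotalSpace F E) := fun x =>
  (contMDiffAt_subtype_iff (U := U) (x := x)).2 (hs x x.2)

/-- The field on `U` given by a section that is smooth on `U`. -/
def FieldOn.ofSection {U : Opens X} (s : ∀ y, E y) (hs : ∀ x ∈ U, SmoothSectionAt n F s x) :
    FieldOn n F E U :=
  ⟨fun x => s x, contMDiff_restrict_section hs⟩

theorem FieldOn.extend_ofSection {U : Opens X} {s : ∀ y, E y}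
    (hs : ∀ x ∈ U, SmoothSectionAt n F s x) {x : X} (hx : x ∈ U) :
    (FieldOn.ofSection s hs).extend x = s x := by
  simp [FieldOn.extend, FieldOn.ofSection, hx]

theorem FieldOn.extend_restrict {U V : Opens X} (h : U ≤ V) (φ : FieldOn n F E V) {x : X}
    (hx : x ∈ U) : (φ.restrict h).extend x = φ.extend x := by
  simp [FieldOn.extend, FieldOn.restrict, hx, h hx]

theorem FieldOn.smooth_extend {U : Opens X} (φ : FieldOn n F E U) {x : X} (hx : x ∈ U) :
    SmoothSectionAt n F φ.extend x :=
  (φ.extend_smooth hx).self_of_nhds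

theorem FieldOn.jet_eq_mk (k : ℕ) {U : Opens X} (φ : FieldOn n F E U) {x : X} (hx : x ∈ U) :
    φ.jet k x = Quotient.mk _ ⟨φ.extend, φ.extend_smooth hx⟩ := by
  unfold FieldOn.jet
  exact congrArg (Quotient.mk _) (dif_pos hx)

theorem FieldOn.jet_congr (k : ℕ) {U V : Opens X} {φ : FieldOn n F E U} {ψ : FieldOn n F E V}
    {x : X} (hxU : x ∈ U) (hxV : x ∈ V) (h : ∀ᶠ y in 𝓝 x, φ.extend y = ψ.extend y) :
    φ.jet k x = ψ.jet k x := by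
  rw [φ.jet_eq_mk k hxU, ψ.jet_eq_mk k hxV]
  exact jet_mk_congr k h

theorem FieldOn.jet_restrict (k : ℕ) {U V : Opens X} (h : U ≤ V) (φ : FieldOn n F E V) {x : X}
    (hx : x ∈ U) : (φ.restrict h).jet k x = φ.jet k x := by
  refine FieldOn.jet_congr k hx (h hx) ?_
  filter_upwards [U.isOpen.mem_nhds hx] with y hy using φ.extend_restrict h hy

/-- Product of a function and a field. -/
def FieldOn.smul {U : Opens X} {χ : X → ℝ} (hχ : ContMDiff (𝓡 n) 𝓘(ℝ) ∞ χ) (φ : FieldOn n F E U) :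
    FieldOn n F E U :=
  FieldOn.ofSection (fun y => χ y • φ.extend y) fun x hx => (hχ x).smul_section (φ.smooth_extend hx)

theorem FieldOn.extend_smul {U : Opens X} {χ : X → ℝ} (hχ : ContMDiff (𝓡 n) 𝓘(ℝ) ∞ χ)
    (φ : FieldOn n F E U) (x : X) : (φ.smul hχ).extend x = χ x • φ.extend x := by
  by_cases hx : x ∈ U
  · exact FieldOn.extend_ofSection _ hx
  · simp [FieldOn.extend, hx]

theorem FieldOn.jet_smul (k : ℕ) {U : Opens X} {χ : X → ℝ} (hχ : ContMDiff (𝓡 n) 𝓘(ℝ) ∞ χ)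
    (φ : FieldOn n F E U) {x : X} (hx : x ∈ U) :
    (φ.smul hχ).jet k x = Jet.smul hχ k x (φ.jet k x) := by
  rw [FieldOn.jet_eq_mk k _ hx, FieldOn.jet_eq_mk k _ hx]
  exact jet_mk_congr k (Eventually.of_forall fun y => φ.extend_smul hχ y)

theorem FieldOn.jet_smul_congr (k : ℕ) {U : Opens X} {χ χ' : X → ℝ}
    (hχ : ContMDiff (𝓡 n) 𝓘(ℝ) ∞ χ) (hχ' : ContMDiff (𝓡 n) 𝓘(ℝ) ∞ χ')
    (φ : FieldOn n F E U) {x : X} (hx : x ∈ U) (h : χ =ᶠ[𝓝 x] χ') :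
    (φ.smul hχ).jet k x = (φ.smul hχ').jet k x := by
  refine FieldOn.jet_congr k hx hx ?_
  filter_upwards [h] with y hy
  rw [φ.extend_smul, φ.extend_smul, hy]

theorem FieldOn.jet_smul_of_eventually_one (k : ℕ) {U : Opens X} {χ : X → ℝ}
    (hχ : ContMDiff (𝓡 n) 𝓘(ℝ) ∞ χ) (φ : FieldOn n F E U) {x : X} (hx : x ∈ U)
    (h : ∀ᶠ y in 𝓝 x, χ y = 1) : (φ.smul hχ).jet k x = φ.jet k x := by
  refine FieldOn.jet_congr k hx hx ?_
  filter_upwards [h] with y hy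
  rw [φ.extend_smul, hy, one_smul]

theorem FieldOn.jet_smul_of_notMem_tsupport (k : ℕ) {U : Opens X} {χ : X → ℝ}
    (hχ : ContMDiff (𝓡 n) 𝓘(ℝ) ∞ χ) (φ : FieldOn n F E U) {x : X} (hx : x ∈ U)
    (h : x ∉ tsupport χ) : (φ.smul hχ).jet k x = Quotient.mk _ (zeroLocalSection n F E x) := by
  rw [FieldOn.jet_eq_mk k _ hx]
  refine jet_mk_congr k ?_
  filter_upwards [(isClosed_tsupport χ).isOpen_compl.mem_nhds h] with y hy
  change (φ.smul hχ).extend y = 0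
  rw [φ.extend_smul, image_eq_zero_of_notMem_tsupport hy, zero_smul]

variable (n F E) in
/-- The zero field. -/
def FieldOn.zero (U : Opens X) : FieldOn n F E U :=
  FieldOn.ofSection (fun _ => 0) fun _ _ => Bundle.contMDiff_zeroSection ℝ E _

theorem FieldOn.jet_zero (k : ℕ) {U : Opens X} {x : X} (hx : x ∈ U) :
    (FieldOn.zero n F E U).jet k x = Quotient.mk _ (zeroLocalSection n F E x) := by
  rw [FieldOn.jet_eq_mk k _ hx]
  refine jet_mk_congr k ?_
  filter_upwards [U.isOpen.mem_nhds hx] with y hy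
  exact FieldOn.extend_ofSection _ hy

/-- Extension of a field on `U` to `V`, after multiplication by a function supported in `U`. -/
def FieldOn.cutoff {U : Opens X} (V : Opens X) {ψ : X → ℝ} (hψ : ContMDiff (𝓡 n) 𝓘(ℝ) ∞ ψ)
    (hψU : tsupport ψ ⊆ U) (φ : FieldOn n F E U) : FieldOn n F E V :=
  FieldOn.ofSection (fun y => ψ y • φ.extend y) fun x _ => by
    by_cases hx : x ∈ U
    · exact (hψ x).smul_section (φ.smooth_extend hx)
    · refine (Bundle.contMDiff_zeroSection ℝ E x).congr_of_eventuallyEq ?_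
      filter_upwards [(isClosed_tsupport ψ).isOpen_compl.mem_nhds fun h => hx (hψU h)] with y hy
      rw [image_eq_zero_of_notMem_tsupport hy, zero_smul]
      rfl

theorem FieldOn.jet_cutoff (k : ℕ) {U V : Opens X} (hUV : U ≤ V) {ψ : X → ℝ}
    (hψ : ContMDiff (𝓡 n) 𝓘(ℝ) ∞ ψ) (hψU : tsupport ψ ⊆ U) (φ : FieldOn n F E U) {x : X}
    (hx : x ∈ U) (h : ∀ᶠ y in 𝓝 x, ψ y = 1) : (φ.cutoff V hψ hψU).jet k x = φ.jet k x := by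
  refine FieldOn.jet_congr k (hUV hx) hx ?_
  filter_upwards [h, V.isOpen.mem_nhds (hUV hx)] with y hy hyV
  exact (FieldOn.extend_ofSection _ hyV).trans (by rw [hy, one_smul])

/-- The evaluation of a Lagrangian on the jets of a field is smooth. -/
theorem IsLagrangian.contMDiffAt_jet {k : ℕ} {U : Opens X} {α : ∀ x, Jet n F E k x → ℝ}
    (hα : IsLagrangian k U α) (φ : FieldOn n F E U) {x : X} (hx : x ∈ U) :
    ContMDiffAt (𝓡 n) 𝓘(ℝ) ∞ (fun y => α y (φ.jet k y)) x := by
  obtain ⟨a, ha, hax⟩ := hα x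
  have hs := mem_extChartAt_source (I := 𝓡 n) x
  have hb := FiberBundle.mem_baseSet_trivializationAt' (F := F) (E := E) x
  have hO : IsOpen {z | z ∈ (extChartAt (𝓡 n) x).target ∧ (extChartAt (𝓡 n) x).symm z ∈ U ∧
      (extChartAt (𝓡 n) x).symm z ∈ (trivializationAt F E x).baseSet} :=
    isOpen_target_inter_preimage n x (U.isOpen.inter (trivializationAt F E x).open_baseSet)
  have h1 : ContDiffAt ℝ ∞ (fun z => a (z, derivs k (localRep n F x φ.extend) z))
      (extChartAt (𝓡 n) x x) := by
    refine ContDiffAt.comp (extChartAt (𝓡 n) x x) (ha.contDiffAt ?_)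
      (contDiffAt_id.prodMk (contDiffAt_derivs k (contDiffAt_localRep hs hb (φ.smooth_extend hx))))
    refine (hO.prod isOpen_univ).mem_nhds ⟨⟨(extChartAt (𝓡 n) x).map_source hs, ?_⟩, mem_univ _⟩
    simp only [extChartAt_to_inv]
    exact ⟨hx, hb⟩
  have h2 := (contMDiffAt_iff_contDiffAt.2 h1).comp x (contMDiffAt_extChartAt (I := 𝓡 n) (x := x))
  refine h2.congr_of_eventuallyEq ?_
  filter_upwards [U.isOpen.mem_nhds hx, extChartAt_source_mem_nhds (I := 𝓡 n) x,
    (trivializationAt F E x).open_baseSet.mem_nhds hb] with y hyU hys hyb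
  rw [φ.jet_eq_mk k hyU]
  exact hax y hyU hys hyb _

end Jets

/-! ### Smooth functions on powers of a manifold -/

section Power

variable {n : ℕ} {X : Type*} [TopologicalSpace X] [ChartedSpace (EuclideanSpace ℝ (Fin n)) X]
  {κ κ' : Type} [Fintype κ] [Fintype κ']

variable (n) in
/-- Smoothness of a function on the product manifold `X^κ`, expressed in product charts. -/
def SmoothPow (h : (κ → X) → ℝ) : Prop :=
  ∀ c : κ → X, ContDiffOn ℝ ∞
    (fun z : κ → EuclideanSpace ℝ (Fin n) => h fun i => (extChartAt (𝓡 n) (c i)).symm (z i))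
    (univ.pi fun i => (extChartAt (𝓡 n) (c i)).target)

theorem smoothPow_fin_iff {m : ℕ} {h : (Fin m → X) → ℝ} : SmoothPow n h ↔ SmoothOnPower n h :=
  Iff.rfl

theorem SmoothPow.continuous {h : (κ → X) → ℝ} (hh : SmoothPow n h) : Continuous h := by
  rw [continuous_iff_continuousAt]
  intro x
  have hO : IsOpen (univ.pi fun i => (extChartAt (𝓡 n) (x i)).target) :=
    isOpen_set_pi finite_univ fun i _ => isOpen_extChartAt_target (x i)
  have h1 : ContinuousAt (fun y : κ → X => fun i => extChartAt (𝓡 n) (x i) (y i)) x :=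
    continuousAt_pi.2 fun i =>
      (continuousAt_extChartAt (x i)).comp (x := x) (continuous_apply i).continuousAt
  have h2 := ((hh x).contDiffAt (hO.mem_nhds (x := fun i => extChartAt (𝓡 n) (x i) (x i))
    fun i _ => mem_extChartAt_target (x i))).continuousAt
  refine (ContinuousAt.comp (f := fun y : κ → X => fun i => extChartAt (𝓡 n) (x i) (y i))
    h2 h1).congr ?_
  have h3 : (univ.pi fun i => (extChartAt (𝓡 n) (x i)).source) ∈ 𝓝 x :=
    set_pi_mem_nhds finite_univ fun i _ => extChartAt_source_mem_nhds (x i)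
  filter_upwards [h3] with y hy
  simp only [Function.comp_apply]
  congr 1
  funext i
  exact (extChartAt (𝓡 n) (x i)).left_inv (hy i (mem_univ i))

theorem SmoothPow.mul {h h' : (κ → X) → ℝ} (hh : SmoothPow n h) (hh' : SmoothPow n h') :
    SmoothPow n fun x => h x * h' x := fun c => (hh c).mul (hh' c)

theorem smoothPow_const (r : ℝ) : SmoothPow n fun _ : κ → X => r := fun _ => contDiffOn_const

theorem SmoothPow.prod {ι : Type*} (s : Finset ι) {h : ι → (κ → X) → ℝ}
    (hh : ∀ i ∈ s, SmoothPow n (h i)) : SmoothPow n fun x => ∏ i ∈ s, h i x := fun c =>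
  contDiffOn_prod fun i hi => hh i hi c

theorem SmoothPow.comp_index {h : (κ → X) → ℝ} (hh : SmoothPow n h) (e : κ → κ') :
    SmoothPow n fun x : κ' → X => h fun i => x (e i) := fun c =>
  (hh fun i => c (e i)).comp (contDiff_pi.2 fun i => contDiff_apply ℝ _ (e i)).contDiffOn
    fun _ hz i _ => hz (e i) (mem_univ _)

theorem ContMDiff.smoothPow [IsManifold (𝓡 n) ∞ X] {ψ : X → ℝ} (hψ : ContMDiff (𝓡 n) 𝓘(ℝ) ∞ ψ)
    (j : κ) : SmoothPow n fun x : κ → X => ψ (x j) := fun c =>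
  (contDiffOn_comp_extChartAt_symm hψ (c j)).comp (contDiff_apply ℝ _ j).contDiffOn
    fun _ hz => hz j (mem_univ j)

/-- The point of `X^κ` with prescribed coordinates in `p` and outside of `p`. -/
def glue {Y : Type*} (p : κ → Prop) [DecidablePred p] (x : {i // p i} → Y) (y : {i // ¬p i} → Y) :
    κ → Y :=
  fun i => if h : p i then x ⟨i, h⟩ else y ⟨i, h⟩

/-- Smoothness of the function obtained by integrating over some of the variables. -/
theorem SmoothPow.integral [T2Space X] [SecondCountableTopology X] [MeasurableSpace X]
    [BorelSpace X] {h : (κ → X) → ℝ} (hh : SmoothPow n h) (p : κ → Prop) [DecidablePred p]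
    {K : Set ({i // ¬p i} → X)} (hK : IsCompact K) (h0 : ∀ x, ∀ y ∉ K, h (glue p x y) = 0)
    (ν : Measure ({i // ¬p i} → X)) [IsFiniteMeasureOnCompacts ν] :
    SmoothPow n fun x => ∫ y, h (glue p x y) ∂ν := by
  intro c
  have hs : IsOpen (univ.pi fun i => (extChartAt (𝓡 n) (c i)).target) :=
    isOpen_set_pi finite_univ fun i _ => isOpen_extChartAt_target (c i)
  refine LocallySmooth.contDiffOn_integral (E' := {i // ¬p i} → EuclideanSpace ℝ (Fin n)) hs hK
    (G := fun z y => h (glue p (fun i => (extChartAt (𝓡 n) (c i)).symm (z i)) y)) ?_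
    fun z _ y hy => h0 _ y hy
  intro y₀
  -- The integrated variables get the charts at the coordinates of $y_0$, and the parameters keep
  -- the charts at $c$. The local expression is that of $h$ in the product chart centred at `glue p
  -- c y₀`.
  refine ⟨fun y i => extChartAt (𝓡 n) (y₀ i) (y i),
    univ.pi fun i => (extChartAt (𝓡 n) (y₀ i)).source,
    univ.pi fun i => (extChartAt (𝓡 n) (y₀ i)).target,
    fun q => h fun i => (extChartAt (𝓡 n) (glue p c y₀ i)).symm (glue p q.1 q.2 i),
    isOpen_set_pi finite_univ fun i _ => isOpen_extChartAt_source (y₀ i),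
    fun i _ => mem_extChartAt_source (y₀ i),
    isOpen_set_pi finite_univ fun i _ => isOpen_extChartAt_target (y₀ i), ?_,
    fun y hy i _ => (extChartAt (𝓡 n) (y₀ i)).map_source (hy i (mem_univ i)), ?_, ?_⟩
  · exact continuousOn_pi.2 fun i => (continuousOn_extChartAt (y₀ i)).comp
      (continuous_apply i).continuousOn fun y hy => hy i (mem_univ i)
  · refine (hh (glue p c y₀)).comp (ContDiff.contDiffOn (contDiff_pi.2 fun i => ?_)) ?_
    · by_cases hi : p i
      · simp only [glue, hi, dite_true]
        exact (contDiff_apply ℝ _ _).comp contDiff_fst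
      · simp only [glue, hi, dite_false]
        exact (contDiff_apply ℝ _ _).comp contDiff_snd
    · intro q hq i _
      by_cases hi : p i
      · simpa only [glue, hi, dite_true] using hq.1 ⟨i, hi⟩ (mem_univ _)
      · simpa only [glue, hi, dite_false] using hq.2 ⟨i, hi⟩ (mem_univ _)
  · intro z _ y hy
    dsimp only
    congr 1
    funext i
    by_cases hi : p i
    · simp only [glue, hi, dite_true]
    · simp only [glue, hi, dite_false]
      exact ((extChartAt (𝓡 n) (y₀ ⟨i, hi⟩)).left_inv (hy ⟨i, hi⟩ (mem_univ _))).symm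

end Power

/-! ### Smooth measures and bump functions -/

section SmoothMeasures

variable {n : ℕ} {X : Type*} [TopologicalSpace X] [ChartedSpace (EuclideanSpace ℝ (Fin n)) X]
  [MeasurableSpace X] [BorelSpace X]

/-- A closed ball inside a chart target is compact and the density is continuous there, so its
preimage is a neighbourhood of finite measure. -/
theorem IsSmoothMeasure.isLocallyFiniteMeasure {ν : Measure X} (hν : IsSmoothMeasure n ν) :
    IsLocallyFiniteMeasure ν := by
  refine ⟨fun x => ?_⟩
  obtain ⟨ρ, hρ, -, h⟩ := hν x
  obtain ⟨ε, hε, hεt⟩ := Metric.nhds_basis_closedBall.mem_iff.1 (extChartAt_target_mem_nhds (I := 𝓡 n) x)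
  set e := extChartAt (𝓡 n) x
  set B := Metric.closedBall (e x) ε
  have hes : MeasurableSet e.source := (isOpen_extChartAt_source x).measurableSet
  have hem : AEMeasurable e (ν.restrict e.source) :=
    (continuousOn_extChartAt x).aemeasurable hes
  refine ⟨e ⁻¹' B ∩ e.source, inter_mem ((continuousAt_extChartAt x).preimage_mem_nhds
    (Metric.closedBall_mem_nhds _ hε)) (extChartAt_source_mem_nhds x), ?_⟩
  have hB : IsCompact B := isCompact_closedBall _ _
  rw [← Measure.restrict_apply' hes, ← Measure.map_apply_of_aemeasurable hem hB.measurableSet, h,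
    withDensity_apply _ hB.measurableSet]
  refine lt_of_le_of_lt (lintegral_mono' (Measure.restrict_mono subset_rfl Measure.restrict_le_self)
    le_rfl) ?_
  have hi : IntegrableOn ρ B := (hρ.continuousOn.mono hεt).integrableOn_compact hB
  exact hi.lintegral_lt_top

variable (n) in
theorem exists_bump [T2Space X] [SecondCountableTopology X] [IsManifold (𝓡 n) ∞ X] {K : Set X}
    (hK : IsCompact K) {U : Opens X} (hKU : K ⊆ U) :
    ∃ ψ : X → ℝ, ContMDiff (𝓡 n) 𝓘(ℝ) ∞ ψ ∧ HasCompactSupport ψ ∧ tsupport ψ ⊆ U ∧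
      ∀ x ∈ K, ∀ᶠ y in 𝓝 x, ψ y = 1 := by
  have := ChartedSpace.locallyCompactSpace (EuclideanSpace ℝ (Fin n)) X
  obtain ⟨L, hL, hKL, hLU⟩ := exists_compact_between hK U.isOpen hKU
  obtain ⟨f, hf1, hf0, -⟩ := exists_contMDiffMap_one_nhds_of_subset_interior (𝓡 n) (n := ⊤)
    hK.isClosed hKL
  have hfL : tsupport f ⊆ L := closure_minimal
    (fun x hx => by_contra fun h => hx (hf0 x h)) hL.isClosed
  refine ⟨f, f.contMDiff, hL.of_isClosed_subset (isClosed_tsupport _) hfL, hfL.trans hLU, ?_⟩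
  intro x hx
  exact (eventually_nhdsSet_iff_forall.1 hf1) x hx

end SmoothMeasures

/-! ### Existence of smooth measures -/

section ExistsMeasure

theorem contDiff_clm_det {V : Type*} [NormedAddCommGroup V] [NormedSpace ℝ V]
    [FiniteDimensional ℝ V] : ContDiff ℝ ∞ fun A : V →L[ℝ] V => A.det := by
  let b := Module.finBasis ℝ V
  have h : (fun A : V →L[ℝ] V => A.det) = fun A : V →L[ℝ] V =>
      ∑ σ : Equiv.Perm (Fin (Module.finrank ℝ V)),
        ((σ.sign : ℤ) : ℝ) * ∏ i, b.coord (σ i) (A (b i)) := by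
    funext A
    change LinearMap.det (A : V →ₗ[ℝ] V) = _
    rw [← LinearMap.det_toMatrix b, Matrix.det_apply']
    simp [LinearMap.toMatrix_apply]
  rw [h]
  refine ContDiff.sum fun σ _ => contDiff_const.mul (contDiff_prod fun i _ => ?_)
  have h1 : ContDiff ℝ ∞ fun x : V => b.coord (σ i) x :=
    (LinearMap.toContinuousLinearMap (b.coord (σ i))).contDiff
  exact h1.comp (contDiff_id.clm_apply contDiff_const)

theorem _root_.ContinuousOn.measurableSet_inter_preimage {Y Z : Type*} [TopologicalSpace Y]
    [MeasurableSpace Y] [OpensMeasurableSpace Y] [TopologicalSpace Z] [MeasurableSpace Z]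
    [BorelSpace Z] {f : Y → Z} {s : Set Y} (hf : ContinuousOn f s) (hs : MeasurableSet s)
    {t : Set Z} (ht : MeasurableSet t) : MeasurableSet (s ∩ f ⁻¹' t) := by
  have h1 : Measurable fun x : s => f x := (continuousOn_iff_continuous_domRestrict.1 hf).measurable
  have h2 := hs.subtype_image (h1 ht)
  convert h2 using 1
  ext x
  simp [and_comm]

variable {n : ℕ} {X : Type*} [TopologicalSpace X] [T2Space X]
  [ChartedSpace (EuclideanSpace ℝ (Fin n)) X] [IsManifold (𝓡 n) ∞ X]

variable (n) in
/-- The coordinates in the chart at `p` of the point with given coordinates in the chart at `q`. -/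
def transition (p q : X) (w : EuclideanSpace ℝ (Fin n)) : EuclideanSpace ℝ (Fin n) :=
  extChartAt (𝓡 n) p ((extChartAt (𝓡 n) q).symm w)

variable (n) in
/-- The domain of `transition`. -/
def transitionDomain (p q : X) : Set (EuclideanSpace ℝ (Fin n)) :=
  {w | w ∈ (extChartAt (𝓡 n) q).target ∧
    (extChartAt (𝓡 n) q).symm w ∈ (extChartAt (𝓡 n) p).source}

theorem isOpen_transitionDomain (p q : X) : IsOpen (transitionDomain n p q) :=
  isOpen_target_inter_preimage n q (isOpen_extChartAt_source p)

theorem transition_mem {p q : X} {w : EuclideanSpace ℝ (Fin n)} (hw : w ∈ transitionDomain n p q) :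
    transition n p q w ∈ transitionDomain n q p := by
  refine ⟨(extChartAt (𝓡 n) p).map_source hw.2, ?_⟩
  rw [transition, (extChartAt (𝓡 n) p).left_inv hw.2]
  exact (extChartAt (𝓡 n) q).map_target hw.1

theorem transition_transition {p q : X} {w : EuclideanSpace ℝ (Fin n)}
    (hw : w ∈ transitionDomain n p q) : transition n q p (transition n p q w) = w := by
  rw [transition, transition, (extChartAt (𝓡 n) p).left_inv hw.2,
    (extChartAt (𝓡 n) q).right_inv hw.1]

theorem contDiffOn_transition (p q : X) :
    ContDiffOn ℝ ∞ (transition n p q) (transitionDomain n p q) := by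
  rw [← contMDiffOn_iff_contDiffOn]
  exact (contMDiffOn_extChartAt (n := ∞) (x := p)).comp
    ((contMDiffOn_extChartAt_symm q).mono fun w hw => hw.1)
    fun w hw => by simpa [extChartAt_source] using hw.2

theorem differentiableAt_transition {p q : X} {w : EuclideanSpace ℝ (Fin n)}
    (hw : w ∈ transitionDomain n p q) : DifferentiableAt ℝ (transition n p q) w :=
  ((contDiffOn_transition p q).contDiffAt ((isOpen_transitionDomain p q).mem_nhds hw)).differentiableAt
    (by simp)

/-- The chain rule for a transition map and its inverse. Nonvanishing makes the absolute value of
the Jacobian smooth. -/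
theorem det_fderiv_transition_ne_zero {p q : X} {w : EuclideanSpace ℝ (Fin n)}
    (hw : w ∈ transitionDomain n p q) : (fderiv ℝ (transition n p q) w).det ≠ 0 := by
  have h1 := (differentiableAt_transition (transition_mem hw)).hasFDerivAt.comp w
    (differentiableAt_transition hw).hasFDerivAt
  have h2 : (transition n q p ∘ transition n p q) =ᶠ[𝓝 w] id := by
    filter_upwards [(isOpen_transitionDomain p q).mem_nhds hw] with v hv
    exact transition_transition hv
  have h3 := h1.unique ((hasFDerivAt_id w).congr_of_eventuallyEq h2)
  have h4 := congrArg (fun A : EuclideanSpace ℝ (Fin n) →L[ℝ] EuclideanSpace ℝ (Fin n) =>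
    LinearMap.det (A : EuclideanSpace ℝ (Fin n) →ₗ[ℝ] EuclideanSpace ℝ (Fin n))) h3
  simp only [ContinuousLinearMap.toLinearMap_comp, LinearMap.det_comp] at h4
  rw [show ((ContinuousLinearMap.id ℝ (EuclideanSpace ℝ (Fin n)) :
    EuclideanSpace ℝ (Fin n) →L[ℝ] EuclideanSpace ℝ (Fin n)) :
    EuclideanSpace ℝ (Fin n) →ₗ[ℝ] EuclideanSpace ℝ (Fin n)) = LinearMap.id from rfl,
    LinearMap.det_id] at h4
  intro h5
  rw [show LinearMap.det ((fderiv ℝ (transition n p q) w : EuclideanSpace ℝ (Fin n) →L[ℝ]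
    EuclideanSpace ℝ (Fin n)) : EuclideanSpace ℝ (Fin n) →ₗ[ℝ] EuclideanSpace ℝ (Fin n)) = 0
    from h5, mul_zero] at h4
  exact zero_ne_one h4

theorem image_transition (p q : X) (A : Set (EuclideanSpace ℝ (Fin n))) :
    transition n p q '' (transitionDomain n p q ∩ A) =
      transitionDomain n q p ∩ transition n q p ⁻¹' A := by
  ext z
  constructor
  · rintro ⟨w, ⟨hw, hA⟩, rfl⟩
    exact ⟨transition_mem hw, by rwa [mem_preimage, transition_transition hw]⟩
  · rintro ⟨hz, hA⟩
    exact ⟨_, ⟨transition_mem hz, hA⟩, transition_transition hz⟩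

variable [MeasurableSpace X] [BorelSpace X]

/-- The density in the chart at `q` of the measure with density `f` in the chart at `p`. -/
def transitionDensity (p q : X) (f : EuclideanSpace ℝ (Fin n) → ℝ) : EuclideanSpace ℝ (Fin n) → ℝ :=
  (transitionDomain n p q).indicator fun w =>
    |(fderiv ℝ (transition n p q) w).det| * f (transition n p q w)

/-- The only problem is at points of the chart at $q$ that lie outside the chart at $p$. The image
of $C$ in $X$ is compact, hence closed as $X$ is Hausdorff, and misses such a point, so the density
is zero near it. -/
theorem contDiffOn_transitionDensity (p q : X) {f : EuclideanSpace ℝ (Fin n) → ℝ}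
    (hf : ContDiff ℝ ∞ f) {C : Set (EuclideanSpace ℝ (Fin n))} (hC : IsCompact C)
    (hCt : C ⊆ (extChartAt (𝓡 n) p).target) (hfC : ∀ z ∉ C, f z = 0) :
    ContDiffOn ℝ ∞ (transitionDensity p q f) (extChartAt (𝓡 n) q).target := by
  intro w hw
  refine ContDiffAt.contDiffWithinAt ?_
  have hO := isOpen_transitionDomain (n := n) p q
  by_cases hwd : w ∈ transitionDomain n p q
  · have hnhds := hO.mem_nhds hwd
    have h1 : ContDiffAt ℝ ∞ (fun w => |(fderiv ℝ (transition n p q) w).det| *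
        f (transition n p q w)) w := by
      refine ContDiffAt.mul (ContDiffAt.abs ?_ (det_fderiv_transition_ne_zero hwd)) ?_
      · exact contDiff_clm_det.contDiffAt.comp w
          (((contDiffOn_transition p q).fderiv_of_isOpen (m := ∞) hO (by simp)).contDiffAt hnhds)
      · exact hf.contDiffAt.comp w ((contDiffOn_transition p q).contDiffAt hnhds)
    refine h1.congr_of_eventuallyEq ?_
    filter_upwards [hnhds] with v hv using indicator_of_mem hv _
  · have hC' : IsClosed ((extChartAt (𝓡 n) p).symm '' C) :=
      (hC.image_of_continuousOn ((continuousOn_extChartAt_symm p).mono hCt)).isClosed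
    have hw' : (extChartAt (𝓡 n) q).symm w ∉ (extChartAt (𝓡 n) p).symm '' C := by
      rintro ⟨z, hz, hzw⟩
      exact hwd ⟨hw, hzw ▸ (extChartAt (𝓡 n) p).map_target (hCt hz)⟩
    refine (contDiffAt_const (c := (0 : ℝ))).congr_of_eventuallyEq ?_
    filter_upwards [(isOpen_target_inter_preimage n q hC'.isOpen_compl).mem_nhds ⟨hw, hw'⟩]
      with v hv
    by_cases hvd : v ∈ transitionDomain n p q
    · rw [transitionDensity, indicator_of_mem hvd, hfC, mul_zero]
      intro h
      exact hv.2 ⟨_, h, (extChartAt (𝓡 n) p).left_inv hvd.2⟩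
    · exact indicator_of_notMem hvd _

/-- The measure on `X` with density `f` in the chart at `p`, supported in this chart. -/
def chartMeasure (p : X) (f : EuclideanSpace ℝ (Fin n) → ℝ) : Measure X :=
  ((volume.restrict (extChartAt (𝓡 n) p).target).withDensity fun z => ENNReal.ofReal (f z)).map
    (extChartAt (𝓡 n) p).symm

theorem chartMeasure_apply (p : X) (f : EuclideanSpace ℝ (Fin n) → ℝ) {B : Set X}
    (hB : MeasurableSet B) :
    chartMeasure p f B = ∫⁻ z in (extChartAt (𝓡 n) p).target ∩ (extChartAt (𝓡 n) p).symm ⁻¹' B,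
      ENNReal.ofReal (f z) := by
  have ht : MeasurableSet (extChartAt (𝓡 n) p).target := (isOpen_extChartAt_target p).measurableSet
  have h1 : AEMeasurable (extChartAt (𝓡 n) p).symm
      ((volume.restrict (extChartAt (𝓡 n) p).target).withDensity fun z => ENNReal.ofReal (f z)) :=
    ((continuousOn_extChartAt_symm p).aemeasurable ht).mono_ac
      (withDensity_absolutelyContinuous _ _)
  have h2 := (continuousOn_extChartAt_symm p).measurableSet_inter_preimage ht hB
  have h3 : NullMeasurableSet ((extChartAt (𝓡 n) p).symm ⁻¹' B)
      (volume.restrict (extChartAt (𝓡 n) p).target) :=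
    ((continuousOn_extChartAt_symm p).aemeasurable ht).nullMeasurableSet_preimage hB
  rw [chartMeasure, Measure.map_apply_of_aemeasurable h1 hB, withDensity_apply₀ _ h3,
    Measure.restrict_restrict₀ h3, inter_comm]

/-- The change of variables formula: in the chart at $q$ the density is multiplied by the Jacobian
of the transition map, and is zero outside the overlap. -/
theorem isSmoothMeasure_chartMeasure (p : X) {f : EuclideanSpace ℝ (Fin n) → ℝ}
    (hf : ContDiff ℝ ∞ f) (hf0 : ∀ z, 0 ≤ f z) {C : Set (EuclideanSpace ℝ (Fin n))}
    (hC : IsCompact C) (hCt : C ⊆ (extChartAt (𝓡 n) p).target) (hfC : ∀ z ∉ C, f z = 0) :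
    IsSmoothMeasure n (chartMeasure p f) := by
  intro q
  refine ⟨transitionDensity p q f, contDiffOn_transitionDensity p q hf hC hCt hfC,
    fun w _ => indicator_nonneg (fun w _ => mul_nonneg (abs_nonneg _) (hf0 _)) w, ?_⟩
  have hs : MeasurableSet (extChartAt (𝓡 n) q).source := (isOpen_extChartAt_source q).measurableSet
  have ht : MeasurableSet (extChartAt (𝓡 n) q).target := (isOpen_extChartAt_target q).measurableSet
  have hd : MeasurableSet (transitionDomain n p q) := (isOpen_transitionDomain p q).measurableSet
  refine Measure.ext fun A hA => ?_
  rw [Measure.map_apply_of_aemeasurable ((continuousOn_extChartAt q).aemeasurable hs) hA,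
    Measure.restrict_apply' hs, inter_comm,
    chartMeasure_apply p f ((continuousOn_extChartAt q).measurableSet_inter_preimage hs hA),
    withDensity_apply _ hA, Measure.restrict_restrict hA]
  have h1 : (extChartAt (𝓡 n) p).target ∩ (extChartAt (𝓡 n) p).symm ⁻¹'
      ((extChartAt (𝓡 n) q).source ∩ extChartAt (𝓡 n) q ⁻¹' A) =
      transition n p q '' (transitionDomain n p q ∩ A) := by
    rw [image_transition]
    ext z
    simp only [transitionDomain, transition, mem_inter_iff, mem_preimage, mem_ofPred_eq, and_assoc]
  rw [h1, lintegral_image_eq_lintegral_abs_det_fderiv_mul volume (hd.inter hA)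
    (fun w hw => (differentiableAt_transition hw.1).hasFDerivAt.hasFDerivWithinAt)
    (fun v hv w hw hvw => by rw [← transition_transition hv.1, hvw, transition_transition hw.1])]
  have h2 : (fun w => ENNReal.ofReal (transitionDensity p q f w)) =
      (transitionDomain n p q).indicator fun w =>
        ENNReal.ofReal |(fderiv ℝ (transition n p q) w).det| *
          ENNReal.ofReal (f (transition n p q w)) := by
    funext w
    by_cases hw : w ∈ transitionDomain n p q
    · simp only [transitionDensity, indicator_of_mem hw, ENNReal.ofReal_mul (abs_nonneg _)]
    · simp only [transitionDensity, indicator_of_notMem hw, ENNReal.ofReal_zero]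
  rw [h2, lintegral_indicator hd, Measure.restrict_restrict hd]
  congr 2
  ext w
  simp only [mem_inter_iff, transitionDomain, mem_ofPred_eq]
  tauto

-- Such a measure, carried by a compact subset of $U$ with nonzero mass, is what makes constants
-- local functionals of degree $1$. It is a bump function in a chart, transported to $X$.
variable (n) in
theorem exists_isSmoothMeasure {U : Opens X} {p : X} (hp : p ∈ U) :
    ∃ (ν : Measure X) (K : Set X), IsSmoothMeasure n ν ∧ IsCompact K ∧ K ⊆ U ∧ ν Kᶜ = 0 ∧
      ν K ≠ 0 := by
  have hO : IsOpen {z | z ∈ (extChartAt (𝓡 n) p).target ∧ (extChartAt (𝓡 n) p).symm z ∈ U} :=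
    isOpen_target_inter_preimage n p U.isOpen
  obtain ⟨ε, hε, hεO⟩ := Metric.nhds_basis_closedBall.mem_iff.1
    (hO.mem_nhds (x := extChartAt (𝓡 n) p p) ⟨mem_extChartAt_target p, by simpa using hp⟩)
  let f : ContDiffBump (extChartAt (𝓡 n) p p) := ⟨ε / 2, ε, half_pos hε, half_lt_self hε⟩
  have hC : IsCompact (Metric.closedBall (extChartAt (𝓡 n) p p) ε) := isCompact_closedBall _ _
  have hCt : Metric.closedBall (extChartAt (𝓡 n) p p) ε ⊆ (extChartAt (𝓡 n) p).target :=
    fun z hz => (hεO hz).1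
  have hfC : ∀ z ∉ Metric.closedBall (extChartAt (𝓡 n) p p) ε, f z = 0 := fun z hz =>
    f.zero_of_le_dist (le_of_lt (by simpa [Metric.mem_closedBall] using hz))
  have hK : IsCompact ((extChartAt (𝓡 n) p).symm '' Metric.closedBall (extChartAt (𝓡 n) p p) ε) :=
    hC.image_of_continuousOn ((continuousOn_extChartAt_symm p).mono hCt)
  refine ⟨chartMeasure p f, _, isSmoothMeasure_chartMeasure p f.contDiff (fun z => f.nonneg) hC hCt
    hfC, hK, ?_, ?_, ?_⟩
  · rintro _ ⟨z, hz, rfl⟩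
    exact (hεO hz).2
  · rw [chartMeasure_apply p _ hK.measurableSet.compl]
    refine (setLIntegral_eq_zero_iff ((continuousOn_extChartAt_symm p).measurableSet_inter_preimage
      (isOpen_extChartAt_target p).measurableSet hK.measurableSet.compl)
      f.continuous.measurable.ennreal_ofReal).2 (Eventually.of_forall fun z hz => ?_)
    rw [hfC z fun h => hz.2 ⟨z, h, rfl⟩, ENNReal.ofReal_zero]
  · rw [chartMeasure_apply p _ hK.measurableSet, ← pos_iff_ne_zero,
      setLIntegral_pos_iff f.continuous.measurable.ennreal_ofReal]
    refine (Metric.measure_ball_pos volume (extChartAt (𝓡 n) p p) hε).trans_le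
      (measure_mono fun z hz => ⟨?_, hCt (Metric.ball_subset_closedBall hz),
        z, Metric.ball_subset_closedBall hz, rfl⟩)
    exact (ENNReal.ofReal_pos.2 (f.pos_of_mem_ball hz)).ne'

end ExistsMeasure

/-! ### Functionals presented by a compactly supported weight -/

section Presentation

variable {n : ℕ} {X : Type*} [TopologicalSpace X] [ChartedSpace (EuclideanSpace ℝ (Fin n)) X]
  [MeasurableSpace X]
  {F : Type*} [NormedAddCommGroup F] [NormedSpace ℝ F]
  {E : X → Type*} [∀ x, AddCommGroup (E x)] [∀ x, Module ℝ (E x)]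
  [∀ x, TopologicalSpace (E x)] [TopologicalSpace (TotalSpace F E)] [FiberBundle F E]
  [VectorBundle ℝ F E]

variable (n F E) in
/-- The data of a functional `φ ↦ ∫ h(x) ∏ᵢ αᵢ(jφ(xᵢ)) νᵢ(xᵢ)` with `h` vanishing outside of `K^κ`,
with Lagrangians `αᵢ` over `U` and smooth nonnegative densities `νᵢ`. -/
structure Presentation (κ : Type) [Fintype κ] (U : Opens X) (K : Set X) where
  weight : (κ → X) → ℝ
  smooth_weight : SmoothPow n weight
  mem_of_weight_ne_zero : ∀ x, weight x ≠ 0 → ∀ i, x i ∈ K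
  order : κ → ℕ
  lagrangian : ∀ i x, Jet n F E (order i) x → ℝ
  isLagrangian : ∀ i, IsLagrangian (order i) U (lagrangian i)
  ref : κ → Measure X
  isSmoothMeasure_ref : ∀ i, IsSmoothMeasure n (ref i)

namespace Presentation

variable {κ κ' : Type} [Fintype κ] [Fintype κ'] {U V : Opens X} {K K' : Set X}

/-- The value of the Lagrangian `αᵢ` on the jet of `φ` at a point. -/
def value (T : Presentation n F E κ U K) (φ : FieldOn n F E V) (i : κ) (x : X) : ℝ :=
  T.lagrangian i x (φ.jet (T.order i) x)

/-- The functional with a given presentation. -/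
def functional (T : Presentation n F E κ U K) (φ : FieldOn n F E V) : ℝ :=
  ∫ x, T.weight x * ∏ i, T.value φ i (x i) ∂Measure.pi T.ref

/-- The weight kills every point with a coordinate outside $K$, so the factors may be changed freely
off $K$. Most manipulations of presentations below reduce to this. -/
theorem weight_mul_congr (T : Presentation n F E κ U K) {a b : κ → X → ℝ}
    (h : ∀ i, ∀ x ∈ K, a i x = b i x) (x : κ → X) :
    T.weight x * ∏ i, a i (x i) = T.weight x * ∏ i, b i (x i) := by
  by_cases hx : T.weight x = 0
  · rw [hx, zero_mul, zero_mul]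
  · rw [Finset.prod_congr rfl fun i _ => h i (x i) (T.mem_of_weight_ne_zero x hx i)]

theorem functional_congr {W : Opens X} (T : Presentation n F E κ U K) {φ : FieldOn n F E V}
    {ψ : FieldOn n F E W} (h : ∀ k, ∀ x ∈ K, φ.jet k x = ψ.jet k x) :
    T.functional φ = T.functional ψ := by
  refine integral_congr_ae (Eventually.of_forall fun x => T.weight_mul_congr ?_ x)
  intro i x hx
  rw [value, value, h _ x hx]

/-- Enlarging the support. -/
def mono (T : Presentation n F E κ U K) (h : K ⊆ K') : Presentation n F E κ U K' :=
  { T with mem_of_weight_ne_zero := fun x hx i => h (T.mem_of_weight_ne_zero x hx i) }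

variable [T2Space X] [SecondCountableTopology X] [IsManifold (𝓡 n) ∞ X] [BorelSpace X]
  [ContMDiffVectorBundle ∞ F E (𝓡 n)]

theorem isLocallyFiniteMeasure_ref (T : Presentation n F E κ U K) (i : κ) :
    IsLocallyFiniteMeasure (T.ref i) := (T.isSmoothMeasure_ref i).isLocallyFiniteMeasure

/-- Relabelling the variables. -/
def reindex (T : Presentation n F E κ U K) (e : κ ≃ κ') : Presentation n F E κ' U K where
  weight y := T.weight fun i => y (e i)
  smooth_weight := T.smooth_weight.comp_index e
  mem_of_weight_ne_zero y hy i := by simpa using T.mem_of_weight_ne_zero _ hy (e.symm i)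
  order i := T.order (e.symm i)
  lagrangian i := T.lagrangian (e.symm i)
  isLagrangian i := T.isLagrangian (e.symm i)
  ref i := T.ref (e.symm i)
  isSmoothMeasure_ref i := T.isSmoothMeasure_ref (e.symm i)

theorem functional_reindex (T : Presentation n F E κ U K) (e : κ ≃ κ') (φ : FieldOn n F E V) :
    (T.reindex e).functional φ = T.functional φ := by
  have := T.isLocallyFiniteMeasure_ref
  have h := (measurePreserving_piCongrLeft T.ref e.symm).integral_comp
    (MeasurableEquiv.measurableEmbedding _) (fun x => T.weight x * ∏ i, T.value φ i (x i))
  rw [functional, functional, ← h]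
  refine integral_congr_ae (Eventually.of_forall fun y => ?_)
  have hy : ∀ i, MeasurableEquiv.piCongrLeft (fun _ => X) e.symm y i = y (e i) := by
    intro i
    have := MeasurableEquiv.piCongrLeft_apply_apply (β := fun _ : κ => X) e.symm y (e i)
    simpa using this
  dsimp only
  simp only [hy]
  congr 1
  · change T.weight (fun i => y (e i)) = T.weight _
    congr 1
    funext i
    exact (hy i).symm
  · exact e.symm.prod_comp (fun i => T.value φ i (y (e i))) ▸ Finset.prod_congr rfl fun i _ => by
      rw [e.apply_symm_apply]; rfl

/-- A presentation has no compactly supported density coefficients. A bump function equal to $1$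
near $K$ supplies them without changing the integrand, and the weight already vanishes off $U^m$. -/
theorem functional_mem_multiLoc_fin {m : ℕ} (T : Presentation n F E (Fin m) U K) (hK : IsCompact K)
    (hKU : K ⊆ U) : (T.functional : FieldOn n F E U → ℝ) ∈ MultiLoc n F E m U := by
  obtain ⟨ψ, hψ, hψc, hψU, hψ1⟩ := exists_bump n hK hKU
  have hsupp : tsupport T.weight ⊆ univ.pi fun _ => K :=
    closure_minimal (fun x hx i _ => T.mem_of_weight_ne_zero x hx i)
      (isClosed_set_pi fun _ _ => hK.isClosed)
  let M : MultiLagrangianDensity n F E m U :=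
    { weight := T.weight
      smooth_weight := T.smooth_weight
      hasCompactSupport_weight := (isCompact_univ_pi fun _ => hK).of_isClosed_subset
        (isClosed_tsupport _) hsupp
      tsupport_weight_subset := fun x hx i => hKU (hsupp hx i (mem_univ i))
      factor := fun i =>
        { order := T.order i
          lagrangian := T.lagrangian i
          isLagrangian := T.isLagrangian i
          density :=
            { ref := T.ref i
              isSmoothMeasure_ref := T.isSmoothMeasure_ref i
              coeff := ψ
              contMDiff_coeff := hψ
              hasCompactSupport_coeff := hψc
              tsupport_coeff_subset := hψU } } }
  refine Submodule.subset_span ⟨M, ?_⟩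
  funext φ
  change ∫ x in {x : Fin m → X | ∀ i, x i ∈ U},
    T.weight x * ∏ i, (T.value φ i (x i) * ψ (x i)) ∂Measure.pi T.ref = _
  rw [setIntegral_eq_integral_of_forall_compl_eq_zero]
  · refine integral_congr_ae (Eventually.of_forall fun x => T.weight_mul_congr
      (a := fun i x => T.value φ i x * ψ x) ?_ x)
    intro i x hx
    rw [(hψ1 x hx).self_of_nhds, mul_one]
  · intro x hx
    rw [mem_ofPred_eq, not_forall] at hx
    obtain ⟨i, hi⟩ := hx
    rw [by_contra fun h => hi (hKU (T.mem_of_weight_ne_zero x h i)), zero_mul]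

theorem functional_mem_multiLoc (T : Presentation n F E κ U K) (hK : IsCompact K)
    (hKU : K ⊆ U) : (T.functional : FieldOn n F E U → ℝ) ∈ MultiLoc n F E (Fintype.card κ) U := by
  have h := (T.reindex (Fintype.equivFin κ)).functional_mem_multiLoc_fin hK hKU
  rwa [show ((T.reindex (Fintype.equivFin κ)).functional : FieldOn n F E U → ℝ) = T.functional from
    funext fun φ => T.functional_reindex _ φ] at h

/-- Extension of a presentation to a larger open set. -/
theorem exists_extension (T : Presentation n F E κ U K) (hK : IsCompact K) (hKU : K ⊆ U)
    (hUV : U ≤ V) : ∃ T' : Presentation n F E κ V K,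
      ∀ φ : FieldOn n F E V, T'.functional φ = T.functional (φ.restrict hUV) := by
  obtain ⟨ψ, hψ, hψc, hψU, hψ1⟩ := exists_bump n hK hKU
  -- The Lagrangians are controlled only over $U$; multiplied by $\psi$ they become Lagrangians over
  -- $V$, unchanged on $K$.
  refine ⟨{ T with
    lagrangian := fun i x j => ψ x * T.lagrangian i x j
    isLagrangian := fun i => (T.isLagrangian i).mul_of_tsupport_subset hψ hψU }, fun φ => ?_⟩
  refine integral_congr_ae (Eventually.of_forall fun x => T.weight_mul_congr
    (a := fun i x => ψ x * T.value φ i x) ?_ x)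
  intro i x hx
  rw [(hψ1 x hx).self_of_nhds, one_mul, value, value, φ.jet_restrict _ hUV (hKU hx)]

/-- The product of two presentations. -/
def prod (T : Presentation n F E κ U K) (T' : Presentation n F E κ' U K') :
    Presentation n F E (κ ⊕ κ') U (K ∪ K') where
  weight x := T.weight (fun i => x (Sum.inl i)) * T'.weight fun i => x (Sum.inr i)
  smooth_weight := (T.smooth_weight.comp_index Sum.inl).mul (T'.smooth_weight.comp_index Sum.inr)
  mem_of_weight_ne_zero x hx i := by
    cases i with
    | inl i => exact Or.inl (T.mem_of_weight_ne_zero _ (left_ne_zero_of_mul hx) i)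
    | inr i => exact Or.inr (T'.mem_of_weight_ne_zero _ (right_ne_zero_of_mul hx) i)
  order := Sum.elim T.order T'.order
  lagrangian := Sum.rec T.lagrangian T'.lagrangian
  isLagrangian := Sum.rec T.isLagrangian T'.isLagrangian
  ref := Sum.elim T.ref T'.ref
  isSmoothMeasure_ref := Sum.rec T.isSmoothMeasure_ref T'.isSmoothMeasure_ref

theorem functional_prod (T : Presentation n F E κ U K) (T' : Presentation n F E κ' U K')
    (φ : FieldOn n F E V) : (T.prod T').functional φ = T.functional φ * T'.functional φ := by
  have := T.isLocallyFiniteMeasure_ref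
  have := T'.isLocallyFiniteMeasure_ref
  have : ∀ i, SigmaFinite ((T.prod T').ref i) := fun i => by
    have := (T.prod T').isLocallyFiniteMeasure_ref i
    infer_instance
  have h := (measurePreserving_sumPiEquivProdPi (T.prod T').ref).integral_comp
    (MeasurableEquiv.measurableEmbedding _) (fun p : (κ → X) × (κ' → X) =>
      (T.weight p.1 * ∏ i, T.value φ i (p.1 i)) * (T'.weight p.2 * ∏ i, T'.value φ i (p.2 i)))
  have h2 := integral_prod_mul (μ := Measure.pi T.ref) (ν := Measure.pi T'.ref)
    (fun x => T.weight x * ∏ i, T.value φ i (x i)) (fun x => T'.weight x * ∏ i, T'.value φ i (x i))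
  rw [functional, functional, functional, ← h2]
  refine Eq.trans (integral_congr_ae (Eventually.of_forall fun x => ?_)) h
  change (T.weight (fun i => x (Sum.inl i)) * T'.weight fun i => x (Sum.inr i)) *
    ∏ i, (T.prod T').value φ i (x i) = (T.weight (fun i => x (Sum.inl i)) *
      ∏ i, T.value φ i (x (Sum.inl i))) * (T'.weight (fun i => x (Sum.inr i)) *
      ∏ i, T'.value φ i (x (Sum.inr i)))
  rw [Fintype.prod_sum_type]
  exact mul_mul_mul_comm _ _ _ _

end Presentation

/-! ### Functionals carried by a compact set, and the algebra they generate -/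

variable [T2Space X] [SecondCountableTopology X] [IsManifold (𝓡 n) ∞ X] [BorelSpace X]
  [ContMDiffVectorBundle ∞ F E (𝓡 n)]

variable (n F E) in
/-- The multilocal functionals of degree `m` on `U` supported in `K`. -/
def MultiLocOn (m : ℕ) (U : Opens X) (K : Set X) : Submodule ℝ (FieldOn n F E U → ℝ) :=
  Submodule.span ℝ (range fun T : Presentation n F E (Fin m) U K => T.functional)

theorem MultiLocOn.mono {m : ℕ} {U : Opens X} {K K' : Set X} (h : K ⊆ K') :
    MultiLocOn n F E m U K ≤ MultiLocOn n F E m U K' := by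
  refine Submodule.span_mono ?_
  rintro _ ⟨T, rfl⟩
  exact ⟨T.mono h, rfl⟩

theorem MultiLocOn.le_multiLoc {m : ℕ} {U : Opens X} {K : Set X} (hK : IsCompact K) (hKU : K ⊆ U) :
    MultiLocOn n F E m U K ≤ MultiLoc n F E m U := by
  refine Submodule.span_le.2 ?_
  rintro _ ⟨T, rfl⟩
  exact T.functional_mem_multiLoc_fin hK hKU

/-- For a pure tensor, $K$ is the union of the coordinate projections of the support of the weight,
and the density coefficients are absorbed into the weight. Sums are carried by the union of the
compact sets. -/
theorem exists_mem_multiLocOn {m : ℕ} {U : Opens X} {f : FieldOn n F E U → ℝ}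
    (hf : f ∈ MultiLoc n F E m U) :
    ∃ K, IsCompact K ∧ K ⊆ (U : Set X) ∧ f ∈ MultiLocOn n F E m U K := by
  induction hf using Submodule.span_induction with
  | mem f hf =>
    obtain ⟨T, rfl⟩ := hf
    refine ⟨⋃ i, (fun x : Fin m → X => x i) '' tsupport T.weight, isCompact_iUnion fun i =>
      T.hasCompactSupport_weight.isCompact.image (continuous_apply i), ?_, ?_⟩
    · refine iUnion_subset fun i => ?_
      rintro _ ⟨x, hx, rfl⟩
      exact T.tsupport_weight_subset hx i
    let M : Presentation n F E (Fin m) U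
        (⋃ i, (fun x : Fin m → X => x i) '' tsupport T.weight) :=
      { weight := fun x => T.weight x * ∏ i, (T.factor i).density.coeff (x i)
        smooth_weight := (smoothPow_fin_iff.2 T.smooth_weight).mul (SmoothPow.prod _ fun i _ =>
          ContMDiff.smoothPow (T.factor i).density.contMDiff_coeff i)
        mem_of_weight_ne_zero := fun x hx i => mem_iUnion.2
          ⟨i, x, subset_tsupport _ (left_ne_zero_of_mul hx), rfl⟩
        order := fun i => (T.factor i).order
        lagrangian := fun i => (T.factor i).lagrangian
        isLagrangian := fun i => (T.factor i).isLagrangian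
        ref := fun i => (T.factor i).density.ref
        isSmoothMeasure_ref := fun i => (T.factor i).density.isSmoothMeasure_ref }
    refine Submodule.subset_span ⟨M, ?_⟩
    funext φ
    change _ = ∫ x in {x : Fin m → X | ∀ i, x i ∈ U},
      T.weight x * ∏ i, ((T.factor i).lagrangian (x i) (φ.jet (T.factor i).order (x i)) *
        (T.factor i).density.coeff (x i)) ∂Measure.pi fun i => (T.factor i).density.ref
    rw [setIntegral_eq_integral_of_forall_compl_eq_zero]
    · refine integral_congr_ae (Eventually.of_forall fun x => ?_)
      beta_reduce
      rw [Finset.prod_mul_distrib]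
      change T.weight x * (∏ i, (T.factor i).density.coeff (x i)) * _ = _
      rw [mul_assoc, mul_comm (∏ i, (T.factor i).density.coeff (x i))]
      rfl
    · intro x hx
      rw [image_eq_zero_of_notMem_tsupport fun h => hx (T.tsupport_weight_subset h), zero_mul]
  | zero => exact ⟨∅, isCompact_empty, empty_subset _, zero_mem _⟩
  | add f g _ _ hf hg =>
    obtain ⟨K, hK, hKU, hf⟩ := hf
    obtain ⟨L, hL, hLU, hg⟩ := hg
    exact ⟨K ∪ L, hK.union hL, union_subset hKU hLU, add_mem
      (MultiLocOn.mono subset_union_left hf) (MultiLocOn.mono subset_union_right hg)⟩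
  | smul c f _ hf =>
    obtain ⟨K, hK, hKU, hf⟩ := hf
    exact ⟨K, hK, hKU, Submodule.smul_mem _ c hf⟩

theorem MultiLocOn.congr {m : ℕ} {U : Opens X} {K : Set X} {f : FieldOn n F E U → ℝ}
    (hf : f ∈ MultiLocOn n F E m U K) {φ ψ : FieldOn n F E U}
    (h : ∀ k, ∀ x ∈ K, φ.jet k x = ψ.jet k x) : f φ = f ψ := by
  induction hf using Submodule.span_induction with
  | mem f hf =>
    obtain ⟨T, rfl⟩ := hf
    exact T.functional_congr h
  | zero => rfl
  | add f g _ _ hf hg => simp only [Pi.add_apply, hf, hg]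
  | smul c f _ hf => simp only [Pi.smul_apply, hf]

theorem comp_restrict_mem_multiLoc {m : ℕ} {U V : Opens X} (h : U ≤ V) {f : FieldOn n F E U → ℝ}
    (hf : f ∈ MultiLoc n F E m U) :
    (fun φ : FieldOn n F E V => f (φ.restrict h)) ∈ MultiLoc n F E m V := by
  obtain ⟨K, hK, hKU, hfK⟩ := exists_mem_multiLocOn hf
  clear hf
  refine MultiLocOn.le_multiLoc hK (hKU.trans h) ?_
  induction hfK using Submodule.span_induction with
  | mem f hf =>
    obtain ⟨T, rfl⟩ := hf
    obtain ⟨T', hT'⟩ := T.exists_extension hK hKU h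
    exact Submodule.subset_span ⟨T', funext hT'⟩
  | zero => exact zero_mem _
  | add f g _ _ hf hg => exact add_mem hf hg
  | smul c f _ hf => exact Submodule.smul_mem _ c hf

theorem mul_mem_multiLoc {a b : ℕ} {U : Opens X} {f g : FieldOn n F E U → ℝ}
    (hf : f ∈ MultiLoc n F E a U) (hg : g ∈ MultiLoc n F E b U) :
    f * g ∈ MultiLoc n F E (a + b) U := by
  obtain ⟨K, hK, hKU, hfK⟩ := exists_mem_multiLocOn hf
  clear hf
  obtain ⟨L, hL, hLU, hgL⟩ := exists_mem_multiLocOn hg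
  clear hg
  induction hfK using Submodule.span_induction with
  | mem f hf =>
    obtain ⟨T, rfl⟩ := hf
    induction hgL using Submodule.span_induction with
    | mem g hg =>
      obtain ⟨S, rfl⟩ := hg
      have h := (T.prod S).functional_mem_multiLoc (hK.union hL) (union_subset hKU hLU)
      rw [Fintype.card_sum, Fintype.card_fin, Fintype.card_fin] at h
      convert h using 1
      exact funext fun φ => (T.functional_prod S φ).symm
    | zero => rw [mul_zero]; exact zero_mem _
    | add f g _ _ hf hg => rw [mul_add]; exact add_mem hf hg
    | smul c f _ hf => rw [mul_smul_comm]; exact Submodule.smul_mem _ c hf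
  | zero => rw [zero_mul]; exact zero_mem _
  | add f g _ _ hf hg => rw [add_mul]; exact add_mem hf hg
  | smul c f _ hf => rw [smul_mul_assoc]; exact Submodule.smul_mem _ c hf

theorem one_mem_multiLoc_zero (U : Opens X) : (1 : FieldOn n F E U → ℝ) ∈ MultiLoc n F E 0 U := by
  let T : Presentation n F E (Fin 0) U ∅ :=
    { weight := fun _ => 1
      smooth_weight := smoothPow_const 1
      mem_of_weight_ne_zero := fun _ _ i => i.elim0
      order := fun i => i.elim0
      lagrangian := fun i => i.elim0
      isLagrangian := fun i => i.elim0
      ref := fun i => i.elim0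
      isSmoothMeasure_ref := fun i => i.elim0 }
  have h := T.functional_mem_multiLoc_fin isCompact_empty (empty_subset _)
  convert h using 1
  funext φ
  have h0 : Measure.pi T.ref = Measure.dirac isEmptyElim := Measure.pi_of_empty _
  rw [Presentation.functional, h0, integral_dirac]
  simp [T]

/-- On a nonempty open set, the constants are local functionals. -/
theorem one_mem_multiLoc_one {U : Opens X} (hU : (U : Set X).Nonempty) :
    (1 : FieldOn n F E U → ℝ) ∈ MultiLoc n F E 1 U := by
  obtain ⟨p, hp⟩ := hU
  obtain ⟨ν, K, hν, hK, hKU, hνK, hνK'⟩ := exists_isSmoothMeasure n hp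
  have := hν.isLocallyFiniteMeasure
  obtain ⟨ψ, hψ, hψc, hψU, hψ1⟩ := exists_bump n hK hKU
  let T : Presentation n F E (Fin 1) U (tsupport ψ) :=
    -- Since $\nu$ is concentrated on $K$, where $\psi=1$, dividing by $\nu(K)$ makes the total
    -- integral $1$.
    { weight := fun x => (ν.real K)⁻¹ * ψ (x 0)
      smooth_weight := (smoothPow_const _).mul (ContMDiff.smoothPow hψ 0)
      mem_of_weight_ne_zero := fun x hx i => by
        rw [Subsingleton.elim i 0]
        exact subset_tsupport _ (right_ne_zero_of_mul hx)
      order := fun i => 0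
      lagrangian := fun i _ _ => 1
      isLagrangian := fun i => isLagrangian_const 0 U 1
      ref := fun i => ν
      isSmoothMeasure_ref := fun i => hν }
  have h := T.functional_mem_multiLoc_fin hψc hψU
  convert h using 1
  funext φ
  have h1 := (measurePreserving_funUnique ν (Fin 1)).integral_comp
    (MeasurableEquiv.measurableEmbedding _) (fun x => (ν.real K)⁻¹ * ψ x)
  have hr : ν.restrict K = ν := Measure.restrict_eq_self_of_ae_mem (mem_ae_iff.2 hνK)
  have h2 : ∫ x, (ν.real K)⁻¹ * ψ x ∂ν = 1 := by
    calc ∫ x, (ν.real K)⁻¹ * ψ x ∂ν = ∫ x in K, (ν.real K)⁻¹ * ψ x ∂ν := by rw [hr]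
      _ = ∫ x in K, (ν.real K)⁻¹ ∂ν := setIntegral_congr_fun hK.measurableSet fun x hx => by
        rw [(hψ1 x hx).self_of_nhds, mul_one]
      _ = 1 := by
        rw [setIntegral_const, smul_eq_mul]
        exact mul_inv_cancel₀ (ENNReal.toReal_ne_zero.2 ⟨hνK', hK.measure_lt_top.ne⟩)
  change (1 : ℝ) = ∫ x : Fin 1 → X, ((ν.real K)⁻¹ * ψ (x 0)) * ∏ i : Fin 1, (1 : ℝ)
    ∂Measure.pi fun _ => ν
  simp only [Finset.prod_const_one, mul_one]
  exact (h1.trans h2).symm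

/-- Multiplication by the constant $1$, taken in degree $1$, raises the degree. This fails on the
empty set, where the functionals of positive degree are zero but $1$ has degree $0$. -/
theorem multiLoc_mono {a b : ℕ} (hab : a ≤ b) {U : Opens X} (hU : (U : Set X).Nonempty) :
    MultiLoc n F E a U ≤ MultiLoc n F E b U := by
  induction b, hab using Nat.le_induction with
  | base => exact le_rfl
  | succ b _ ih =>
    intro f hf
    have h := mul_mem_multiLoc (ih hf) (one_mem_multiLoc_one hU)
    rwa [mul_one] at h

end Presentation

/-! ### Localization of functionals -/

section Localization

variable {n : ℕ} {X : Type*} [TopologicalSpace X] [ChartedSpace (EuclideanSpace ℝ (Fin n)) X]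
  [MeasurableSpace X]
  {F : Type*} [NormedAddCommGroup F] [NormedSpace ℝ F]
  {E : X → Type*} [∀ x, AddCommGroup (E x)] [∀ x, Module ℝ (E x)]
  [∀ x, TopologicalSpace (E x)] [TopologicalSpace (TotalSpace F E)] [FiberBundle F E]
  [VectorBundle ℝ F E] [T2Space X] [SecondCountableTopology X] [IsManifold (𝓡 n) ∞ X] [BorelSpace X]
  [ContMDiffVectorBundle ∞ F E (𝓡 n)]

omit [T2Space X] [SecondCountableTopology X] [MeasurableSpace X] [BorelSpace X] in
theorem contMDiff_mul_of_tsupport_subset {U : Opens X} {θ f : X → ℝ}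
    (hθ : ContMDiff (𝓡 n) 𝓘(ℝ) ∞ θ) (hθU : tsupport θ ⊆ U)
    (hf : ∀ x ∈ U, ContMDiffAt (𝓡 n) 𝓘(ℝ) ∞ f x) :
    ContMDiff (𝓡 n) 𝓘(ℝ) ∞ fun x => θ x * f x := by
  intro x
  by_cases hx : x ∈ U
  · exact (hθ x).mul (hf x hx)
  · refine (contMDiffAt_const (c := (0 : ℝ))).congr_of_eventuallyEq ?_
    filter_upwards [(isClosed_tsupport θ).isOpen_compl.mem_nhds fun h => hx (hθU h)] with y hy
    rw [image_eq_zero_of_notMem_tsupport hy, zero_mul]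

/-! ### Localizing one presentation by a cutoff of the field -/

namespace Presentation

variable {κ : Type} [Fintype κ] {U V : Opens X} {K : Set X}

/-- Replacing the factors on $K$ by globally smooth functions makes the integrand continuous with
compact support, hence integrable. -/
theorem exists_contMDiff_eqOn_value (T : Presentation n F E κ U K) (hK : IsCompact K) (hKU : K ⊆ U)
    (φ : FieldOn n F E U) (i : κ) :
    ∃ g : X → ℝ, ContMDiff (𝓡 n) 𝓘(ℝ) ∞ g ∧ ∀ x ∈ K, g x = T.value φ i x := by
  obtain ⟨θ, hθ, -, hθU, hθ1⟩ := exists_bump n hK hKU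
  refine ⟨_, contMDiff_mul_of_tsupport_subset hθ hθU
    fun x hx => (T.isLagrangian i).contMDiffAt_jet φ hx, fun x hx => ?_⟩
  rw [(hθ1 x hx).self_of_nhds, one_mul]
  rfl

theorem integrable_of_contMDiff (T : Presentation n F E κ U K) (hK : IsCompact K)
    {a : κ → X → ℝ} (ha : ∀ i, ∃ g : X → ℝ, ContMDiff (𝓡 n) 𝓘(ℝ) ∞ g ∧ ∀ x ∈ K, g x = a i x) :
    Integrable (fun x => T.weight x * ∏ i, a i (x i)) (Measure.pi T.ref) := by
  have := T.isLocallyFiniteMeasure_ref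
  choose g hg hga using ha
  have h1 : SmoothPow n fun x => T.weight x * ∏ i, g i (x i) :=
    T.smooth_weight.mul (SmoothPow.prod _ fun i _ => ContMDiff.smoothPow (hg i) i)
  have h2 : Integrable (fun x => T.weight x * ∏ i, g i (x i)) (Measure.pi T.ref) := by
    refine h1.continuous.integrable_of_hasCompactSupport
      (HasCompactSupport.intro (isCompact_univ_pi fun _ => hK) fun x hx => ?_)
    rw [by_contra fun h => hx fun i _ => T.mem_of_weight_ne_zero x h i, zero_mul]
  exact h2.congr (Eventually.of_forall fun x => T.weight_mul_congr hga x)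

theorem integrable (T : Presentation n F E κ U K) (hK : IsCompact K) (hKU : K ⊆ U)
    (φ : FieldOn n F E U) :
    Integrable (fun x => T.weight x * ∏ i, T.value φ i (x i)) (Measure.pi T.ref) :=
  T.integrable_of_contMDiff hK fun i => T.exists_contMDiff_eqOn_value hK hKU φ i

/-- If some of the factors do not depend on the field, they can be integrated out. -/
theorem exists_integral_eq (T : Presentation n F E κ U K) (hK : IsCompact K) {U' : Opens X}
    (hU' : U' ≤ U) {χ : X → ℝ} (hχ : ContMDiff (𝓡 n) 𝓘(ℝ) ∞ χ) {ψ : X → ℝ}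
    (hψ : ContMDiff (𝓡 n) 𝓘(ℝ) ∞ ψ) (hψc : HasCompactSupport ψ) (hψU : tsupport ψ ⊆ U')
    {b : κ → X → ℝ} (hb : ∀ i, ContMDiff (𝓡 n) 𝓘(ℝ) ∞ (b i)) (p : κ → Prop) [DecidablePred p] :
    ∃ g ∈ MultiLoc n F E (Fintype.card {i // p i}) U', ∀ φ : FieldOn n F E U,
      Integrable (fun x => T.weight x * ∏ i,
        if p i then ψ (x i) * T.value (φ.smul hχ) i (x i) else b i (x i)) (Measure.pi T.ref) →
      ∫ x, T.weight x * ∏ i,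
        (if p i then ψ (x i) * T.value (φ.smul hχ) i (x i) else b i (x i)) ∂Measure.pi T.ref =
      g (φ.restrict hU') := by
  have := T.isLocallyFiniteMeasure_ref
  have hH : SmoothPow n fun x => T.weight x * ∏ i : {i // ¬p i}, b i (x i) :=
    T.smooth_weight.mul (SmoothPow.prod _ fun i _ => ContMDiff.smoothPow (hb i) (i : κ))
  have hKc : IsCompact (univ.pi fun _ : {i // ¬p i} => K) := isCompact_univ_pi fun _ => hK
  have hH0 : ∀ (x : {i // p i} → X) (y : {i // ¬p i} → X), y ∉ (univ.pi fun _ => K) →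
      T.weight (glue p x y) * ∏ i : {i // ¬p i}, b i (glue p x y i) = 0 := by
    intro x y hy
    have h0 : T.weight (glue p x y) = 0 := by
      by_contra h
      refine hy fun i _ => ?_
      have := T.mem_of_weight_ne_zero _ h i
      rwa [glue, dif_neg i.2] at this
    rw [h0, zero_mul]
  -- The variables outside $p$ are integrated into the weight, the factors $\psi$ confine the
  -- remaining ones to $U'$, and multiplication by $\chi$ moves from the field into the Lagrangians.
  let S : Presentation n F E {i // p i} U' (tsupport ψ) :=
    { weight := fun x => (∏ i, ψ (x i)) * ∫ y : {i // ¬p i} → X, T.weight (glue p x y) *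
        ∏ i : {i // ¬p i}, b i (glue p x y i) ∂Measure.pi fun i : {i // ¬p i} => T.ref i
      smooth_weight := (SmoothPow.prod _ fun i _ => ContMDiff.smoothPow hψ i).mul
        (hH.integral p hKc hH0 _)
      mem_of_weight_ne_zero := fun x hx i => subset_tsupport _
        (Finset.prod_ne_zero_iff.1 (left_ne_zero_of_mul hx) i (Finset.mem_univ i))
      order := fun i => T.order i
      lagrangian := fun i x j => T.lagrangian i x (Jet.smul hχ _ x j)
      isLagrangian := fun i => ((T.isLagrangian i).comp_smul hχ).mono hU'
      ref := fun i => T.ref i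
      isSmoothMeasure_ref := fun i => T.isSmoothMeasure_ref i }
  refine ⟨S.functional, S.functional_mem_multiLoc hψc hψU, fun φ hφ => ?_⟩
  have hmp := (measurePreserving_piEquivPiSubtypeProd T.ref p).symm
  have hemb := (MeasurableEquiv.piEquivPiSubtypeProd (fun _ : κ => X) p).symm.measurableEmbedding
  refine ((hmp.integral_comp hemb _).symm.trans
    (integral_prod _ ((hmp.integrable_comp_emb hemb).2 hφ))).trans ?_
  refine integral_congr_ae (Eventually.of_forall fun x => ?_)
  -- Outside $U'$ the restricted field has only a default jet; $\psi$ vanishes there, so the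
  -- mismatch does not matter.
  have hS : ∀ i : {i // p i}, ψ (x i) * S.value (φ.restrict hU') i (x i) =
      ψ (x i) * T.value (φ.smul hχ) i (x i) := by
    intro i
    by_cases hx : x i ∈ U'
    · change ψ (x i) * T.lagrangian i (x i) (Jet.smul hχ _ (x i) _) =
        ψ (x i) * T.lagrangian i (x i) _
      rw [φ.jet_restrict _ hU' hx, φ.jet_smul _ hχ (hU' hx)]
    · rw [image_eq_zero_of_notMem_tsupport fun h => hx (hψU h), zero_mul, zero_mul]
  calc ∫ y : {i // ¬p i} → X, T.weight (glue p x y) * ∏ i, (if p i then ψ (glue p x y i) *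
        T.value (φ.smul hχ) i (glue p x y i) else b i (glue p x y i))
        ∂Measure.pi (fun i : {i // ¬p i} => T.ref i)
      = ∫ y : {i // ¬p i} → X, (∏ i : {i // p i}, ψ (x i) * T.value (φ.smul hχ) i (x i)) *
        (T.weight (glue p x y) * ∏ i : {i // ¬p i}, b i (glue p x y i))
        ∂Measure.pi (fun i : {i // ¬p i} => T.ref i) := by
        refine integral_congr_ae (Eventually.of_forall fun y => ?_)
        beta_reduce
        rw [← Fintype.prod_subtype_mul_prod_subtype p, mul_left_comm]
        congr 1
        · refine Finset.prod_congr rfl fun i _ => ?_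
          rw [if_pos i.2, glue, dif_pos i.2]
        · congr 1
          exact Finset.prod_congr rfl fun i _ => if_neg i.2
    _ = S.weight x * ∏ i, S.value (φ.restrict hU') i (x i) := by
        rw [integral_const_mul, ← Finset.prod_congr rfl fun i _ => hS i, Finset.prod_mul_distrib]
        change _ = (∏ i, ψ (x i)) * _ * _
        ring

/-- After multiplication of the field with a function `χ`, the functional lives on every nonempty
neighbourhood of `K ∩ supp χ`. -/
theorem exists_functional_smul_eq (T : Presentation n F E κ U K) (hK : IsCompact K) (hKU : K ⊆ U)
    {χ : X → ℝ} (hχ : ContMDiff (𝓡 n) 𝓘(ℝ) ∞ χ) {U' : Opens X} (hU' : U' ≤ U)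
    (hχU : K ∩ tsupport χ ⊆ U') (hne : (U' : Set X).Nonempty ∨ Fintype.card κ = 0) :
    ∃ g ∈ MultiLoc n F E (Fintype.card κ) U', ∀ φ : FieldOn n F E U,
      T.functional (φ.smul hχ) = g (φ.restrict hU') := by
  classical
  obtain ⟨ψ, hψ, hψc, hψU, hψ1⟩ := exists_bump n (hK.inter_right (isClosed_tsupport χ)) hχU
  choose v hv hvK using fun i => T.exists_contMDiff_eqOn_value hK hKU (FieldOn.zero n F E U) i
  have hb : ∀ i, ContMDiff (𝓡 n) 𝓘(ℝ) ∞ fun x => (1 - ψ x) * v i x := fun i =>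
    (contMDiff_const.sub hψ).mul (hv i)
  -- On $K$ the $i$-th factor equals $\psi\,\alpha_i(j(\chi\phi)) + (1-\psi)\,v_i$, where $v_i$ is
  -- its value at the zero field. Expanding the product gives one term for each choice $p$ of
  -- summands.
  have key : ∀ p : κ → Bool, ∃ g ∈ MultiLoc n F E (Fintype.card κ) U', ∀ φ : FieldOn n F E U,
      Integrable (fun x => T.weight x * ∏ i, if p i then ψ (x i) * T.value (φ.smul hχ) i (x i)
        else (1 - ψ (x i)) * v i (x i)) (Measure.pi T.ref) →
      ∫ x, T.weight x * ∏ i, (if p i then ψ (x i) * T.value (φ.smul hχ) i (x i)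
        else (1 - ψ (x i)) * v i (x i)) ∂Measure.pi T.ref = g (φ.restrict hU') := by
    intro p
    obtain ⟨g, hg, hgφ⟩ := T.exists_integral_eq hK hU' hχ hψ hψc hψU hb fun i => p i = true
    have hle : Fintype.card {i // p i = true} ≤ Fintype.card κ := Fintype.card_subtype_le _
    refine ⟨g, ?_, hgφ⟩
    -- The term for $p$ has degree the number of retained factors. It is raised to the full degree
    -- on a nonempty $U'$; with no variables at all the degrees already agree.
    rcases hne with hne | hne
    · exact multiLoc_mono hle hne hg
    · rwa [show Fintype.card κ = Fintype.card {i // p i = true} by omega]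
  choose g hg hgφ using key
  refine ⟨∑ p, g p, Submodule.sum_mem _ fun p _ => hg p, fun φ => ?_⟩
  have hint : ∀ p : κ → Bool, Integrable (fun x => T.weight x * ∏ i,
      if p i then ψ (x i) * T.value (φ.smul hχ) i (x i) else (1 - ψ (x i)) * v i (x i))
      (Measure.pi T.ref) := by
    intro p
    refine T.integrable_of_contMDiff hK (a := fun i x => if p i then ψ x * T.value (φ.smul hχ) i x
      else (1 - ψ x) * v i x) fun i => ?_
    by_cases hp : p i = true
    · obtain ⟨w, hw, hwK⟩ := T.exists_contMDiff_eqOn_value hK hKU (φ.smul hχ) i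
      exact ⟨_, hψ.mul hw, fun x hx => by simp only [if_pos hp, Pi.mul_apply, hwK x hx]⟩
    · exact ⟨_, hb i, fun x hx => by simp only [if_neg hp]⟩
  rw [Finset.sum_apply, ← Finset.sum_congr rfl fun p _ => hgφ p φ (hint p),
    ← integral_finsetSum _ fun p _ => hint p]
  refine integral_congr_ae (Eventually.of_forall fun x => ?_)
  beta_reduce
  rw [T.weight_mul_congr (a := T.value (φ.smul hχ)) (b := fun i x => ∑ c : Bool, if c = true then
    ψ x * T.value (φ.smul hχ) i x else (1 - ψ x) * v i x) ?_ x, ← Finset.mul_sum]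
  · congr 1
    rw [Finset.prod_univ_sum, Fintype.piFinset_univ]
  · intro i x hx
    rw [Fintype.sum_bool, if_pos rfl, if_neg (by simp), hvK i x hx]
    -- On $\operatorname{supp}\chi$ the bump $\psi$ is $1$ and only the first summand remains. Off
    -- it, the jet of $\chi\phi$ is the zero jet and the two summands add up to $v_i$.
    by_cases h : x ∈ tsupport χ
    · rw [(hψ1 x ⟨hx, h⟩).self_of_nhds]; ring
    · rw [show T.value (φ.smul hχ) i x = T.value (FieldOn.zero n F E U) i x by
        rw [value, value, φ.jet_smul_of_notMem_tsupport _ hχ (hKU hx) h, FieldOn.jet_zero _ (hKU hx)]]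
      ring

end Presentation

theorem MultiLocOn.exists_comp_smul_eq {m : ℕ} {U : Opens X} {K : Set X} {f : FieldOn n F E U → ℝ}
    (hf : f ∈ MultiLocOn n F E m U K) (hK : IsCompact K) (hKU : K ⊆ U)
    {χ : X → ℝ} (hχ : ContMDiff (𝓡 n) 𝓘(ℝ) ∞ χ) {U' : Opens X} (hU' : U' ≤ U)
    (hχU : K ∩ tsupport χ ⊆ U') (hne : (U' : Set X).Nonempty ∨ m = 0) :
    ∃ g ∈ MultiLoc n F E m U', ∀ φ : FieldOn n F E U, f (φ.smul hχ) = g (φ.restrict hU') := by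
  induction hf using Submodule.span_induction with
  | mem f hf =>
    obtain ⟨T, rfl⟩ := hf
    obtain ⟨g, hg, h⟩ := T.exists_functional_smul_eq hK hKU hχ hU' hχU (by simpa using hne)
    rw [Fintype.card_fin] at hg
    exact ⟨g, hg, h⟩
  | zero => exact ⟨0, zero_mem _, fun φ => rfl⟩
  | add f f' _ _ hf hf' =>
    obtain ⟨g, hg, h⟩ := hf
    obtain ⟨g', hg', h'⟩ := hf'
    exact ⟨g + g', add_mem hg hg', fun φ => by simp only [Pi.add_apply, h, h']⟩
  | smul c f _ hf =>
    obtain ⟨g, hg, h⟩ := hf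
    exact ⟨c • g, Submodule.smul_mem _ c hg, fun φ => by simp only [Pi.smul_apply, h]⟩

/-! ### Finite differences -/

section Moebius

variable {A : Type*} [DecidableEq A]

/-- The alternating sum of a set function over the subsets of `S`. -/
def alternatingSum (G : Finset A → ℝ) (S : Finset A) : ℝ :=
  ∑ T ∈ S.powerset, (-1) ^ (S.card + T.card) * G T

theorem alternatingSum_insert (G : Finset A → ℝ) {S : Finset A} {a : A} (ha : a ∉ S) :
    alternatingSum G (insert a S) =
      alternatingSum (fun T => G (insert a T)) S - alternatingSum G S := by
  have h1 : ∀ T ∈ S.powerset, (-1 : ℝ) ^ ((insert a S).card + (insert a T).card) * G (insert a T) =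
      (-1) ^ (S.card + T.card) * G (insert a T) := by
    intro T hT
    rw [Finset.card_insert_of_notMem ha,
      Finset.card_insert_of_notMem fun h => ha (Finset.mem_powerset.1 hT h)]
    ring
  have h2 : ∀ T ∈ S.powerset, (-1 : ℝ) ^ ((insert a S).card + T.card) * G T =
      -((-1) ^ (S.card + T.card) * G T) := by
    intro T _
    rw [Finset.card_insert_of_notMem ha]
    ring
  rw [alternatingSum, Finset.sum_powerset_insert ha, Finset.sum_congr rfl h1,
    Finset.sum_congr rfl h2, Finset.sum_neg_distrib, alternatingSum, alternatingSum]
  ring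

/-- Möbius inversion on the Boolean lattice. Splitting the subsets of $S\cup\{a\}$ by whether they
contain $a$ makes the terms in $G$ on subsets of $S$ cancel. -/
theorem sum_alternatingSum (G : Finset A → ℝ) (S : Finset A) :
    ∑ T ∈ S.powerset, alternatingSum G T = G S := by
  induction S using Finset.induction_on generalizing G with
  | empty => simp [alternatingSum]
  | insert a S ha ih =>
    rw [Finset.sum_powerset_insert ha, Finset.sum_congr rfl fun T hT =>
      alternatingSum_insert G fun h => ha (Finset.mem_powerset.1 hT h), Finset.sum_sub_distrib,
      ih, ih]
    ring

theorem alternatingSum_eq_zero (G : Finset A → ℝ) {S : Finset A} {a : A} (ha : a ∈ S)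
    (hG : ∀ T, a ∉ T → G (insert a T) = G T) : alternatingSum G S = 0 := by
  rw [← Finset.insert_erase ha, alternatingSum_insert G (Finset.notMem_erase a S), sub_eq_zero]
  refine Finset.sum_congr rfl fun T hT => ?_
  beta_reduce
  rw [hG T fun h => Finset.notMem_erase a S (Finset.mem_powerset.1 hT h)]

end Moebius

/-! ### Finite differences of functionals and the resulting decomposition -/

section FiniteDifferences

variable {A : Type*} [Fintype A] [DecidableEq A] {χ : A → X → ℝ}

omit [T2Space X] [SecondCountableTopology X] [MeasurableSpace X] [BorelSpace X] in
theorem contMDiff_sum_apply (hχ : ∀ a, ContMDiff (𝓡 n) 𝓘(ℝ) ∞ (χ a)) (S : Finset A) :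
    ContMDiff (𝓡 n) 𝓘(ℝ) ∞ fun x => ∑ a ∈ S, χ a x :=
  contMDiff_finsetSum fun a _ => hχ a

/-- The sets of indices `a` such that the supports of the functions `χ a` are met by the coordinates
of a single point of `K^m`. -/
def MeetSupports (m : ℕ) (K : Set X) (χ : A → X → ℝ) (S : Finset A) : Prop :=
  ∃ x : Fin m → X, (∀ j, x j ∈ K) ∧ ∀ a ∈ S, ∃ j, x j ∈ tsupport (χ a)

omit [MeasurableSpace X] [BorelSpace X] [T2Space X] [SecondCountableTopology X]
  [IsManifold (𝓡 n) ∞ X] [ChartedSpace (EuclideanSpace ℝ (Fin n)) X] in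
theorem MeetSupports.mono {m : ℕ} {K L : Set X} (h : K ⊆ L) {S : Finset A}
    (hS : MeetSupports m K χ S) : MeetSupports m L χ S :=
  let ⟨x, hx, hxS⟩ := hS
  ⟨x, fun j => h (hx j), hxS⟩

/-- The integrand already vanishes pointwise: at each point where the weight is nonzero, some $a\in
S$ has no coordinate in $\operatorname{supp}\chi_a$. Adding $\chi_a$ to the cutoff then changes no
jet there, and the terms cancel in pairs. -/
theorem Presentation.alternatingSum_functional {m : ℕ} {U : Opens X} {K : Set X}
    (T : Presentation n F E (Fin m) U K) (hK : IsCompact K) (hKU : K ⊆ U)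
    (hχ : ∀ a, ContMDiff (𝓡 n) 𝓘(ℝ) ∞ (χ a)) {S : Finset A} (hS : ¬MeetSupports m K χ S)
    (φ : FieldOn n F E U) :
    alternatingSum (fun R => T.functional (φ.smul (contMDiff_sum_apply hχ R))) S = 0 := by
  have h1 : alternatingSum (fun R => T.functional (φ.smul (contMDiff_sum_apply hχ R))) S =
      ∫ x, alternatingSum (fun R => T.weight x * ∏ i,
        T.value (φ.smul (contMDiff_sum_apply hχ R)) i (x i)) S ∂Measure.pi T.ref := by
    simp only [alternatingSum]
    rw [integral_finsetSum _ fun R _ => (T.integrable hK hKU _).const_mul _]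
    exact Finset.sum_congr rfl fun R _ => (integral_const_mul _ _).symm
  rw [h1]
  refine integral_eq_zero_of_ae (Eventually.of_forall fun x => ?_)
  change alternatingSum _ S = 0
  by_cases hx : T.weight x = 0
  · simp only [alternatingSum, hx, zero_mul, mul_zero, Finset.sum_const_zero]
  have hxK := T.mem_of_weight_ne_zero x hx
  have : ∃ a ∈ S, ∀ j, x j ∉ tsupport (χ a) := by
    by_contra! h
    exact hS ⟨x, hxK, h⟩
  obtain ⟨a, ha, hax⟩ := this
  refine alternatingSum_eq_zero _ ha fun R hR => ?_
  congr 1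
  refine Finset.prod_congr rfl fun i _ => ?_
  rw [Presentation.value, Presentation.value]
  congr 1
  refine FieldOn.jet_smul_congr _ _ _ φ (hKU (hxK i)) ?_
  filter_upwards [(isClosed_tsupport (χ a)).isOpen_compl.mem_nhds (hax i)] with y hy
  rw [Finset.sum_insert hR, image_eq_zero_of_notMem_tsupport hy, zero_add]

theorem MultiLocOn.alternatingSum_eq_zero {m : ℕ} {U : Opens X} {K : Set X}
    {f : FieldOn n F E U → ℝ} (hf : f ∈ MultiLocOn n F E m U K) (hK : IsCompact K) (hKU : K ⊆ U)
    (hχ : ∀ a, ContMDiff (𝓡 n) 𝓘(ℝ) ∞ (χ a)) {S : Finset A} (hS : ¬MeetSupports m K χ S)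
    (φ : FieldOn n F E U) :
    alternatingSum (fun R => f (φ.smul (contMDiff_sum_apply hχ R))) S = 0 := by
  induction hf using Submodule.span_induction with
  | mem f hf =>
    obtain ⟨T, rfl⟩ := hf
    exact T.alternatingSum_functional hK hKU hχ hS φ
  | zero => simp [alternatingSum]
  | add f g _ _ hf hg =>
    have : ∀ G H : Finset A → ℝ, alternatingSum (fun R => G R + H R) S =
        alternatingSum G S + alternatingSum H S := fun G H => by
      simp only [alternatingSum, mul_add, Finset.sum_add_distrib]
    simp only [Pi.add_apply, this, hf, hg, add_zero]
  | smul c f _ hf =>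
    have : ∀ G : Finset A → ℝ, alternatingSum (fun R => c * G R) S = c * alternatingSum G S :=
      fun G => by simp only [alternatingSum, mul_left_comm, Finset.mul_sum]
    simp only [Pi.smul_apply, smul_eq_mul, this, hf, mul_zero]

/-- The coefficients in the decomposition `MultiLocOn.eq_sum_coeff`. -/
def decompositionCoeff (m : ℕ) (K : Set X) (χ : A → X → ℝ) (R : Finset A) : ℝ :=
  open scoped Classical in
  ∑ S : Finset A, if MeetSupports m K χ S ∧ R ⊆ S then (-1) ^ (S.card + R.card) else 0

omit [MeasurableSpace X] [BorelSpace X] [T2Space X] [SecondCountableTopology X]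
  [IsManifold (𝓡 n) ∞ X] [ChartedSpace (EuclideanSpace ℝ (Fin n)) X] in
theorem meetSupports_of_coeff_ne_zero {m : ℕ} {K : Set X} {R : Finset A}
    (h : decompositionCoeff m K χ R ≠ 0) : MeetSupports m K χ R := by
  obtain ⟨S, -, hS⟩ := Finset.exists_ne_zero_of_sum_ne_zero h
  have hS' : MeetSupports m K χ S ∧ R ⊆ S := by
    by_contra hn
    exact hS (if_neg hn)
  obtain ⟨⟨x, hx, hxS⟩, hR⟩ := hS'
  exact ⟨x, hx, fun a ha => hxS a (hR ha)⟩

/-- Möbius inversion with the vanishing alternating sums dropped. The coefficients refer to a larger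
set $L$, so functionals carried by different compact sets share the same coefficients. -/
theorem MultiLocOn.eq_sum_coeff {m : ℕ} {U : Opens X} {K L : Set X}
    {f : FieldOn n F E U → ℝ} (hf : f ∈ MultiLocOn n F E m U K) (hK : IsCompact K) (hKU : K ⊆ U)
    (hKL : K ⊆ L) (hχ : ∀ a, ContMDiff (𝓡 n) 𝓘(ℝ) ∞ (χ a))
    (hχ1 : ∀ x ∈ K, ∀ᶠ y in 𝓝 x, ∑ a, χ a y = 1) (φ : FieldOn n F E U) :
    f φ = ∑ R, decompositionCoeff m L χ R * f (φ.smul (contMDiff_sum_apply hχ R)) := by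
  classical
  have h0 : f φ = f (φ.smul (contMDiff_sum_apply hχ Finset.univ)) :=
    MultiLocOn.congr hf fun k x hx =>
      (FieldOn.jet_smul_of_eventually_one k _ φ (hKU hx) (hχ1 x hx)).symm
  have h1 := sum_alternatingSum (fun R => f (φ.smul (contMDiff_sum_apply hχ R))) Finset.univ
  rw [h0, ← h1, Finset.powerset_univ]
  have h2 : ∀ S : Finset A, alternatingSum (fun R => f (φ.smul (contMDiff_sum_apply hχ R))) S =
      ∑ R : Finset A, (if MeetSupports m L χ S ∧ R ⊆ S then (-1 : ℝ) ^ (S.card + R.card) else 0) *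
        f (φ.smul (contMDiff_sum_apply hχ R)) := by
    intro S
    by_cases hS : MeetSupports m L χ S
    · simp only [hS, true_and, ite_mul, zero_mul]
      rw [← Finset.sum_filter, alternatingSum]
      refine Finset.sum_congr ?_ fun _ _ => rfl
      ext R
      simp
    · simp only [hS, false_and, if_false, zero_mul, Finset.sum_const_zero]
      exact MultiLocOn.alternatingSum_eq_zero hf hK hKU hχ (fun h => hS (h.mono hKL)) φ
  rw [Finset.sum_congr rfl fun S _ => h2 S, Finset.sum_comm]
  refine Finset.sum_congr rfl fun R _ => ?_
  rw [decompositionCoeff, Finset.sum_mul]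

end FiniteDifferences

end Localization

/-! ### The cosheaf property in a fixed degree -/

section Cosheaf

variable {n : ℕ} {X : Type*} [TopologicalSpace X] [ChartedSpace (EuclideanSpace ℝ (Fin n)) X]
  [T2Space X] [SecondCountableTopology X] [IsManifold (𝓡 n) ∞ X]

variable (n) in
/-- Partitions of unity that are fine with respect to a Weiss cover. -/
theorem IsWeissCover.exists_partition {ι : Type*} {U : ι → Opens X} {V : Opens X}
    (hU : IsWeissCover U V) {K : Set X} (hK : IsCompact K) (hKV : K ⊆ V) (m : ℕ) :
    ∃ (N : ℕ) (χ : Fin N → X → ℝ), (∀ a, ContMDiff (𝓡 n) 𝓘(ℝ) ∞ (χ a)) ∧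
      (∀ x ∈ K, ∀ᶠ y in 𝓝 x, ∑ a, χ a y = 1) ∧
      ∀ x : Fin m → X, (∀ j, x j ∈ K) → ∃ k, (∀ j, x j ∈ U k) ∧
        ∀ a, (∃ j, x j ∈ tsupport (χ a)) → tsupport (χ a) ⊆ U k := by
  classical
  have := ChartedSpace.locallyCompactSpace (EuclideanSpace ℝ (Fin n)) X
  let := metrizableSpaceMetric X
  -- The Weiss condition, applied to the coordinates of a point of $K^m$, says exactly that the
  -- powers $U_k^m$ cover $K^m$.
  obtain ⟨δ, hδ, hδU⟩ := lebesgue_number_lemma_of_metric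
    (s := univ.pi fun _ : Fin m => K) (c := fun k => {y : Fin m → X | ∀ j, y j ∈ U k})
    (isCompact_univ_pi fun _ => hK)
    (fun k => by
      simp only [ofPred_forall]
      exact isOpen_iInter_of_finite fun j => (U k).isOpen.preimage (continuous_apply j))
    (fun x hx => by
      obtain ⟨k, hk⟩ := hU.2 (Finset.univ.image x) fun y hy => by
        obtain ⟨j, -, rfl⟩ := Finset.mem_image.1 hy
        exact hKV (hx j (mem_univ j))
      exact mem_iUnion.2 ⟨k, fun j => hk _ (Finset.mem_image_of_mem x (Finset.mem_univ j))⟩)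
  -- The partition of unity is taken over a compact neighbourhood of $K$, so that the sum is $1$
  -- near $K$ and not only on it.
  obtain ⟨L, hL, hKL, -⟩ := exists_compact_between hK isOpen_univ (subset_univ K)
  obtain ⟨t, -, ht⟩ := hL.elim_nhds_subcover (fun p => Metric.ball p (δ / 3))
    fun p _ => Metric.ball_mem_nhds p (by positivity)
  obtain ⟨f, hf⟩ := SmoothPartitionOfUnity.exists_isSubordinate (𝓡 n) hL.isClosed
    (fun p : t => Metric.ball (p : X) (δ / 3)) (fun _ => Metric.isOpen_ball)
    (fun x hx => by simpa using ht hx)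
  refine ⟨t.card, fun a => f (t.equivFin.symm a), fun a => (f _).contMDiff, ?_, ?_⟩
  · intro x hx
    filter_upwards [isOpen_interior.mem_nhds (hKL hx)] with y hy
    rw [t.equivFin.symm.sum_comp fun p => f p y, ← finsum_eq_sum_of_fintype]
    exact f.sum_eq_one (interior_subset hy)
  · intro x hx
    obtain ⟨k, hk⟩ := hδU x fun j _ => hx j
    refine ⟨k, hk (Metric.mem_ball_self hδ), ?_⟩
    rintro a ⟨j, hj⟩ y hy
    have h1 : dist (x j) _ < δ / 3 := hf _ hj
    have h2 : dist y _ < δ / 3 := hf _ hy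
    have h3 : dist y (x j) < δ := by
      linarith [dist_triangle_right y (x j) (t.equivFin.symm a : X)]
    -- Two points of one support are less than $2\delta/3$ apart. Replacing the coordinate $x_j$ by
    -- $y$ thus stays in the $\delta$-ball about $x$, which lies in $U_k^m$, and so $y\in U_k$.
    have h4 : Function.update x j y ∈ Metric.ball x δ := by
      rw [Metric.mem_ball, dist_pi_lt_iff hδ]
      intro i
      by_cases hi : i = j
      · subst hi; simpa using h3
      · simpa [hi] using hδ
    simpa using hk h4 j

variable [MeasurableSpace X] [BorelSpace X]
  {F : Type*} [NormedAddCommGroup F] [NormedSpace ℝ F]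
  {E : X → Type*} [∀ x, AddCommGroup (E x)] [∀ x, Module ℝ (E x)]
  [∀ x, TopologicalSpace (E x)] [TopologicalSpace (TotalSpace F E)] [FiberBundle F E]
  [VectorBundle ℝ F E] [ContMDiffVectorBundle ∞ F E (𝓡 n)]

theorem FieldOn.restrict_smul {U V : Opens X} (h : U ≤ V) {χ : X → ℝ}
    (hχ : ContMDiff (𝓡 n) 𝓘(ℝ) ∞ χ) (φ : FieldOn n F E V) :
    (φ.smul hχ).restrict h = (φ.restrict h).smul hχ := by
  refine Subtype.ext (funext fun x => ?_)
  change χ x • φ.extend x = χ x • (φ.restrict h).extend x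
  rw [φ.extend_restrict h x.2]

/-- Extension of multilocal functionals of degree `m` to a larger open set. -/
def MultiLoc.ext (m : ℕ) {U V : Opens X} (h : U ≤ V) :
    MultiLoc n F E m U →ₗ[ℝ] MultiLoc n F E m V where
  toFun f := ⟨fun φ => f.1 (φ.restrict h), comp_restrict_mem_multiLoc h f.2⟩
  map_add' _ _ := rfl
  map_smul' _ _ := rfl

/-- Injectivity of extension. A field on $U$ need not extend to $V$, but its cutoff does, and it has
the same jets on the compact set carrying $f$. -/
theorem MultiLoc.eq_zero_of_restrict {m : ℕ} {U V : Opens X} (h : U ≤ V)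
    {f : MultiLoc n F E m U} (hf : ∀ φ : FieldOn n F E V, f.1 (φ.restrict h) = 0) : f = 0 := by
  obtain ⟨K, hK, hKU, hfK⟩ := exists_mem_multiLocOn f.2
  obtain ⟨ψ, hψ, -, hψU, hψ1⟩ := exists_bump n hK hKU
  refine Subtype.ext (funext fun φ => ?_)
  refine Eq.trans (MultiLocOn.congr hfK fun k x hx => ?_) (hf (φ.cutoff V hψ hψU))
  rw [FieldOn.jet_restrict k h _ (hKU hx), φ.jet_cutoff k h hψ hψU (hKU hx) (hψ1 x hx)]

theorem MultiLocOn.eq_zero_of_empty {m : ℕ} (hm : m ≠ 0) {U : Opens X} {K : Set X} (hK : K = ∅)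
    {f : FieldOn n F E U → ℝ} (hf : f ∈ MultiLocOn n F E m U K) : f = 0 := by
  subst hK
  induction hf using Submodule.span_induction with
  | mem f hf =>
    obtain ⟨T, rfl⟩ := hf
    funext φ
    have h : ∀ x, T.weight x = 0 := fun x => by_contra fun h =>
      T.mem_of_weight_ne_zero x h ⟨0, Nat.pos_of_ne_zero hm⟩
    simp [Presentation.functional, h]
  | zero => rfl
  | add f g _ _ hf hg => rw [hf, hg, add_zero]
  | smul c f _ hf => rw [hf, smul_zero]

variable (n F E) in
/-- The constant functional, on a nonempty open set. -/
def MultiLoc.const (m : ℕ) {U : Opens X} (hU : (U : Set X).Nonempty) (c : ℝ) :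
    MultiLoc n F E m U :=
  c • ⟨1, multiLoc_mono (Nat.zero_le m) hU (one_mem_multiLoc_zero U)⟩

/-! ### Compatible families of linear maps over a Weiss cover -/

section Cocone

variable {m : ℕ} {ι : Type*} {U : ι → Opens X} {V : Opens X} {Q : Type*} [AddCommGroup Q]
  [Module ℝ Q] {r : ∀ i, MultiLoc n F E m (U i) →ₗ[ℝ] Q}

/-- Two members of the cover may be disjoint. A third one containing a point of each has nonempty
intersection with both, and the constant is transported through it. -/
theorem IsWeissCover.cocone_const (hU : IsWeissCover U V)
    (hr : ∀ i j (f : MultiLoc n F E m (U i ⊓ U j)),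
      r i (MultiLoc.ext m inf_le_left f) = r j (MultiLoc.ext m inf_le_right f))
    {i k : ι} (hi : (U i : Set X).Nonempty) (hk : (U k : Set X).Nonempty) (c : ℝ) :
    r i (MultiLoc.const n F E m hi c) = r k (MultiLoc.const n F E m hk c) := by
  classical
  have h : ∀ i j (hi : (U i : Set X).Nonempty) (hj : (U j : Set X).Nonempty),
      ((U i ⊓ U j : Opens X) : Set X).Nonempty →
      r i (MultiLoc.const n F E m hi c) = r j (MultiLoc.const n F E m hj c) :=
    fun i j _ _ hij => hr i j (MultiLoc.const n F E m hij c)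
  obtain ⟨p, hp⟩ := hi
  obtain ⟨q, hq⟩ := hk
  obtain ⟨l, hl⟩ := hU.2 {p, q} (by
    intro x hx
    rcases Finset.mem_insert.1 hx with rfl | hx
    · exact hU.1 i hp
    · rw [Finset.mem_singleton.1 hx]
      exact hU.1 k hq)
  have hpl : p ∈ U l := hl p (by simp)
  have hql : q ∈ U l := hl q (by simp)
  exact (h i l _ ⟨p, hpl⟩ ⟨p, hp, hpl⟩).trans (h l k _ _ ⟨q, hql, hq⟩)

/-- The cutoff functional $f(\chi\,\cdot)$ comes from $U_i\cap U_k$, where the two maps agree. If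
that intersection is empty and $m\neq0$, there may be no nonzero constant on it to use, and
constants are compared directly on $U_i$ and $U_k$. -/
theorem IsWeissCover.exists_cocone_eq (hU : IsWeissCover U V)
    (hr : ∀ i j (f : MultiLoc n F E m (U i ⊓ U j)),
      r i (MultiLoc.ext m inf_le_left f) = r j (MultiLoc.ext m inf_le_right f))
    {i k : ι} {K : Set X} {f : FieldOn n F E (U i) → ℝ} (hf : f ∈ MultiLocOn n F E m (U i) K)
    (hK : IsCompact K) (hKU : K ⊆ U i) {χ : X → ℝ} (hχ : ContMDiff (𝓡 n) 𝓘(ℝ) ∞ χ)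
    (hχk : tsupport χ ⊆ U k) (hk : m ≠ 0 → (U k : Set X).Nonempty) :
    ∃ (h : MultiLoc n F E m (U i)) (g : MultiLoc n F E m (U k)),
      (∀ φ, h.1 φ = f (φ.smul hχ)) ∧
      (∀ φ : FieldOn n F E V, g.1 (φ.restrict (hU.1 k)) = h.1 (φ.restrict (hU.1 i))) ∧
      r i h = r k g := by
  by_cases hik : ((U i ⊓ U k : Opens X) : Set X).Nonempty ∨ m = 0
  · obtain ⟨g, hg, hgφ⟩ := MultiLocOn.exists_comp_smul_eq hf hK hKU hχ (U' := U i ⊓ U k)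
      inf_le_left (fun x hx => ⟨hKU hx.1, hχk hx.2⟩) hik
    exact ⟨MultiLoc.ext m inf_le_left ⟨g, hg⟩, MultiLoc.ext m inf_le_right ⟨g, hg⟩,
      fun φ => (hgφ φ).symm, fun φ => rfl, hr i k _⟩
  · push Not at hik
    obtain ⟨hik, hm⟩ := hik
    -- An empty $U_i$ forces $f=0$. Otherwise $\operatorname{supp}\chi$ misses $K$, so $f(\chi\phi)$
    -- is the constant $f(0)$.
    rcases (U i : Set X).eq_empty_or_nonempty with hi | hi
    · have hf0 := MultiLocOn.eq_zero_of_empty hm (subset_empty_iff.1 (hi ▸ hKU)) hf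
      exact ⟨0, 0, fun φ => by rw [hf0]; rfl, fun φ => rfl, by rw [map_zero, map_zero]⟩
    · refine ⟨MultiLoc.const n F E m hi (f (FieldOn.zero n F E (U i))),
        MultiLoc.const n F E m (hk hm) (f (FieldOn.zero n F E (U i))), fun φ => ?_, fun φ => rfl,
        hU.cocone_const hr hi (hk hm) _⟩
      refine Eq.trans (mul_one _) (MultiLocOn.congr hf fun k x hx => ?_)
      rw [φ.jet_smul_of_notMem_tsupport k hχ (hKU hx), FieldOn.jet_zero k (hKU hx)]
      intro h
      exact (hik ▸ (⟨hKU hx, hχk h⟩ : x ∈ ((U i ⊓ U _ : Opens X) : Set X)) : x ∈ (∅ : Set X))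

omit [MeasurableSpace X] [BorelSpace X] [T2Space X] [SecondCountableTopology X]
  [IsManifold (𝓡 n) ∞ X] [ChartedSpace (EuclideanSpace ℝ (Fin n)) X] in
theorem tsupport_sum_subset {A : Type*} (S : Finset A) {χ : A → X → ℝ} {W : Set X}
    (h : ∀ a ∈ S, tsupport (χ a) ⊆ W) : tsupport (fun x => ∑ a ∈ S, χ a x) ⊆ W := by
  have hc : IsClosed (⋃ a ∈ S, tsupport (χ a)) :=
    isClosed_biUnion_finset fun a _ => isClosed_tsupport (χ a)
  refine (closure_minimal (fun x hx => ?_) hc).trans (iUnion₂_subset h)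
  obtain ⟨a, ha, hax⟩ := Finset.exists_ne_zero_of_sum_ne_zero hx
  exact mem_iUnion₂.2 ⟨a, ha, subset_tsupport _ hax⟩

/-- The index of a member of a Weiss cover that contains the supports of the functions in a family
whose supports are met by the coordinates of a single point. -/
theorem exists_index {K : Set X} {N : ℕ} {χ : Fin N → X → ℝ}
    (h : ∀ x : Fin m → X, (∀ j, x j ∈ K) → ∃ k, (∀ j, x j ∈ U k) ∧
        ∀ a, (∃ j, x j ∈ tsupport (χ a)) → tsupport (χ a) ⊆ U k)
    {R : Finset (Fin N)} (hR : MeetSupports m K χ R) :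
    ∃ k, tsupport (fun x => ∑ a ∈ R, χ a x) ⊆ U k ∧ (m ≠ 0 → (U k : Set X).Nonempty) := by
  obtain ⟨x, hxK, hx⟩ := hR
  obtain ⟨k, hxk, hk⟩ := h x hxK
  exact ⟨k, tsupport_sum_subset R fun a ha => hk a (hx a ha),
    fun hm => ⟨_, hxk ⟨0, Nat.pos_of_ne_zero hm⟩⟩⟩

/-- Each term of the decomposition with nonzero coefficient comes from a single member of the cover.
Stated for a submodule $P$, this gives surjectivity when $P$ is the preimage of the range. -/
theorem IsWeissCover.mem_of_forall_ext_mem (hU : IsWeissCover U V)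
    (P : Submodule ℝ (MultiLoc n F E m V))
    (hP : ∀ i (f : MultiLoc n F E m (U i)), MultiLoc.ext m (hU.1 i) f ∈ P)
    (f : MultiLoc n F E m V) : f ∈ P := by
  obtain ⟨K, hK, hKV, hfK⟩ := exists_mem_multiLocOn f.2
  obtain ⟨N, χ, hχ, hχ1, hχU⟩ := hU.exists_partition n hK hKV m
  have h1 : ∀ R : Finset (Fin N), ∃ g ∈ P, ∀ φ, decompositionCoeff m K χ R *
      f.1 (φ.smul (contMDiff_sum_apply hχ R)) = g.1 φ := by
    intro R
    by_cases hR : decompositionCoeff m K χ R = 0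
    · exact ⟨0, zero_mem _, fun φ => by rw [hR, zero_mul]; rfl⟩
    obtain ⟨k, hk, hne⟩ := exists_index hχU (meetSupports_of_coeff_ne_zero hR)
    obtain ⟨g, hg, hgφ⟩ := MultiLocOn.exists_comp_smul_eq hfK hK hKV (contMDiff_sum_apply hχ R)
      (hU.1 k) (fun x hx => hk hx.2) (by tauto)
    refine ⟨_, P.smul_mem (decompositionCoeff m K χ R) (hP k ⟨g, hg⟩), fun φ => ?_⟩
    rw [hgφ]
    rfl
  choose g hg hgφ using h1
  have h2 : f = ∑ R, g R := by
    refine Subtype.ext (funext fun φ => ?_)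
    rw [MultiLocOn.eq_sum_coeff hfK hK hKV subset_rfl hχ hχ1 φ, Submodule.coe_sum,
      Finset.sum_apply]
    exact Finset.sum_congr rfl fun R _ => hgφ R φ
  rw [h2]
  exact P.sum_mem fun R _ => hg R

/-- A family of functionals whose extensions to `V` add up to zero is annihilated by every family
of linear maps that is compatible with restriction to intersections. -/
theorem IsWeissCover.sum_cocone_eq_zero (hU : IsWeissCover U V)
    (hr : ∀ i j (f : MultiLoc n F E m (U i ⊓ U j)),
      r i (MultiLoc.ext m inf_le_left f) = r j (MultiLoc.ext m inf_le_right f))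
    (s : Finset ι) (f : ∀ i, MultiLoc n F E m (U i))
    (hf : ∑ i ∈ s, MultiLoc.ext m (hU.1 i) (f i) = 0) : ∑ i ∈ s, r i (f i) = 0 := by
  have hf' : ∀ φ : FieldOn n F E V, ∑ i ∈ s, (f i).1 (φ.restrict (hU.1 i)) = 0 := by
    intro φ
    have := congrFun (congrArg Subtype.val hf) φ
    rw [Submodule.coe_sum, Finset.sum_apply] at this
    exact this
  choose K hK hKU hfK using fun i => exists_mem_multiLocOn (f i).2
  -- One compact set and one partition are used for all $f_i$, so that the coefficients do not
  -- depend on $i$ and the relation among the $f_i$ survives in each term.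
  have hL : IsCompact (⋃ i ∈ s, K i) := s.isCompact_biUnion fun i _ => hK i
  obtain ⟨N, χ, hχ, hχ1, hχU⟩ := hU.exists_partition n hL
    (iUnion₂_subset fun i _ => (hKU i).trans (hU.1 i)) m
  set L := ⋃ i ∈ s, K i
  have key : ∀ R : Finset (Fin N), ∃ h : ∀ i, MultiLoc n F E m (U i),
      (∀ i φ, decompositionCoeff m L χ R * (f i).1 (φ.smul (contMDiff_sum_apply hχ R)) =
        (h i).1 φ) ∧ ∑ i ∈ s, r i (h i) = 0 := by
    intro R
    by_cases hR : decompositionCoeff m L χ R = 0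
    · exact ⟨0, fun i φ => by rw [hR, zero_mul]; rfl, by simp⟩
    obtain ⟨k, hk, hne⟩ := exists_index hχU (meetSupports_of_coeff_ne_zero hR)
    choose h g hh hg hrg using fun i => hU.exists_cocone_eq hr (hfK i) (hK i) (hKU i)
      (contMDiff_sum_apply hχ R) hk hne
    -- The extension of this sum to $V$, evaluated at $\phi$, is the given relation evaluated at
    -- $\chi_R\phi$; injectivity of extension concludes.
    have hg0 : ∑ i ∈ s, g i = 0 := by
      refine MultiLoc.eq_zero_of_restrict (hU.1 k) fun φ => ?_
      rw [Submodule.coe_sum, Finset.sum_apply, ← hf' (φ.smul (contMDiff_sum_apply hχ R))]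
      refine Finset.sum_congr rfl fun i _ => ?_
      rw [hg, hh, FieldOn.restrict_smul]
    refine ⟨fun i => decompositionCoeff m L χ R • h i, fun i φ => ?_, ?_⟩
    · rw [← hh]
      rfl
    · simp only [map_smul, hrg, ← Finset.smul_sum, ← map_sum, hg0, map_zero, smul_zero]
  choose h hh hrh using key
  have h2 : ∀ i ∈ s, f i = ∑ R, h R i := by
    intro i hi
    refine Subtype.ext (funext fun φ => ?_)
    have hKL : K i ⊆ L := subset_iUnion₂_of_subset i hi subset_rfl
    rw [MultiLocOn.eq_sum_coeff (hfK i) (hK i) (hKU i) hKL hχ (fun x hx => hχ1 x (hKL hx)) φ,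
      Submodule.coe_sum, Finset.sum_apply]
    exact Finset.sum_congr rfl fun R _ => hh R i φ
  rw [Finset.sum_congr rfl fun i hi => by rw [h2 i hi, map_sum], Finset.sum_comm]
  exact Finset.sum_eq_zero fun R _ => hrh R

end Cocone

end Cosheaf

universe v

/-! ### The factorization algebra of multilocal functionals -/

namespace PrefactorizationAlgebra

variable {X : Type*} [TopologicalSpace X] {A : Opens X → Type v} [∀ U, AddCommGroup (A U)]
  [∀ U, Module ℝ (A U)] (P : PrefactorizationAlgebra A) {ι : Type w} {U : ι → Opens X} {V : Opens X}

open scoped Classical in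
theorem sumExt_lof (hV : ∀ i, U i ≤ V) (i : ι) (x : A (U i)) :
    P.sumExt U V hV (lof ℝ ι (fun i => A (U i)) i x) = P.ext (hV i) x := by
  rw [sumExt, toModule_lof]

open scoped Classical in
theorem sumExt_eq_sum (hV : ∀ i, U i ≤ V) (y : ⨁ i, A (U i)) :
    P.sumExt U V hV y = ∑ i ∈ DFinsupp.support y, P.ext (hV i) (y i) := by
  conv_lhs => rw [← sum_support_of y, map_sum]
  exact Finset.sum_congr rfl fun i _ => P.sumExt_lof hV i (y i)

open scoped Classical in
theorem overlapDiff_lof (p : ι × ι) (x : A (U p.1 ⊓ U p.2)) :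
    P.overlapDiff U (lof ℝ (ι × ι) (fun p : ι × ι => A (U p.1 ⊓ U p.2)) p x) =
      lof ℝ ι (fun i => A (U i)) p.1 (P.ext inf_le_left x) -
        lof ℝ ι (fun i => A (U i)) p.2 (P.ext inf_le_right x) := by
  rw [overlapDiff, toModule_lof]
  rfl

/-- Exactness is tested in the quotient by the range of the overlap map: the canonical maps into it
agree on overlaps, so they kill every family whose extensions sum to zero. The universe of `Q` is
the one in which this quotient lives. -/
theorem exact_overlapDiff_sumExt (hV : ∀ i, U i ≤ V)
    (hext : ∀ i j (x : A (U i ⊓ U j)),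
      P.ext (hV i) (P.ext inf_le_left x) = P.ext (hV j) (P.ext inf_le_right x))
    (hcocone : ∀ (Q : Type (max w v)) [AddCommGroup Q] [Module ℝ Q] (r : ∀ i, A (U i) →ₗ[ℝ] Q),
      (∀ i j (x : A (U i ⊓ U j)), r i (P.ext inf_le_left x) = r j (P.ext inf_le_right x)) →
      ∀ (s : Finset ι) (y : ∀ i, A (U i)), ∑ i ∈ s, P.ext (hV i) (y i) = 0 →
        ∑ i ∈ s, r i (y i) = 0) :
    Function.Exact (P.overlapDiff U) (P.sumExt U V hV) := by
  classical
  refine fun y => ⟨fun hy => ?_, ?_⟩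
  · let R := LinearMap.range (P.overlapDiff U)
    refine (Submodule.Quotient.mk_eq_zero R).1 ?_
    change R.mkQ y = 0
    conv_lhs => rw [← sum_support_of y, map_sum]
    refine hcocone _ (fun i => R.mkQ ∘ₗ lof ℝ ι (fun i => A (U i)) i) (fun i j x => ?_) _ _
      ((P.sumExt_eq_sum hV y).symm.trans hy)
    exact (Submodule.Quotient.eq R).2 ⟨_, P.overlapDiff_lof (i, j) x⟩
  · rintro ⟨x, rfl⟩
    have h : P.sumExt U V hV ∘ₗ P.overlapDiff U = 0 := by
      refine linearMap_ext ℝ fun p => LinearMap.ext fun x => ?_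
      rw [LinearMap.comp_apply, LinearMap.comp_apply, overlapDiff_lof, map_sub, sumExt_lof,
        sumExt_lof, hext, sub_self]
      rfl
    exact LinearMap.congr_fun h x

end PrefactorizationAlgebra

section FactorizationAlgebra

variable {n : ℕ} {X : Type*} [TopologicalSpace X] [ChartedSpace (EuclideanSpace ℝ (Fin n)) X]
  [T2Space X] [SecondCountableTopology X] [IsManifold (𝓡 n) ∞ X]
  [MeasurableSpace X] [BorelSpace X]
  {F : Type*} [NormedAddCommGroup F] [NormedSpace ℝ F]
  {E : X → Type*} [∀ x, AddCommGroup (E x)] [∀ x, Module ℝ (E x)]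
  [∀ x, TopologicalSpace (E x)] [TopologicalSpace (TotalSpace F E)] [FiberBundle F E]
  [VectorBundle ℝ F E] [ContMDiffVectorBundle ∞ F E (𝓡 n)]

/-- This makes the direct sum over all degrees a commutative graded algebra, which supplies the
structure maps as products. -/
instance gradedMonoid_multiLoc (U : Opens X) :
    SetLike.GradedMonoid fun m : ℕ => MultiLoc n F E m U where
  one_mem := one_mem_multiLoc_zero U
  mul_mem _ _ _ _ hf hg := mul_mem_multiLoc hf hg

/-- Extension of multilocal functionals to a larger open set. -/
def MLoc.extHom {U V : Opens X} (h : U ≤ V) : MLoc n F E U →ₐ[ℝ] MLoc n F E V :=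
  toAlgebra ℝ (fun m : ℕ => MultiLoc n F E m U)
    (fun m => lof ℝ ℕ (fun m => MultiLoc n F E m V) m ∘ₗ MultiLoc.ext m h) rfl fun {i j} f g =>
      (of_mul_of (A := fun m : ℕ => MultiLoc n F E m V) (MultiLoc.ext i h f)
        (MultiLoc.ext j h g)).symm

theorem MLoc.extHom_lof {U V : Opens X} (h : U ≤ V) (m : ℕ) (f : MultiLoc n F E m U) :
    MLoc.extHom h (lof ℝ ℕ (fun m => MultiLoc n F E m U) m f) =
      lof ℝ ℕ (fun m => MultiLoc n F E m V) m (MultiLoc.ext m h f) :=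
  toModule_lof (R := ℝ) (M := fun m : ℕ => MultiLoc n F E m U)
    (φ := fun m => lof ℝ ℕ (fun m => MultiLoc n F E m V) m ∘ₗ MultiLoc.ext m h) m f

theorem MLoc.extHom_apply {U V : Opens X} (h : U ≤ V) (x : MLoc n F E U) (m : ℕ) :
    MLoc.extHom h x m = MultiLoc.ext m h (x m) := by
  have h1 : (MLoc.extHom h).toLinearMap = lmap (R := ℝ) fun m => MultiLoc.ext (n := n) (F := F)
      (E := E) m h := by
    refine linearMap_ext ℝ fun m => LinearMap.ext fun f => ?_
    refine (MLoc.extHom_lof h m f).trans ?_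
    exact (lmap_lof (R := ℝ) (fun m => MultiLoc.ext (n := n) (F := F) (E := E) m h) m f).symm
  exact congrArg (fun y : MLoc n F E V => y m) (LinearMap.congr_fun h1 x)

theorem MLoc.extHom_self (U : Opens X) (x : MLoc n F E U) : MLoc.extHom (le_refl U) x = x := by
  refine DFinsupp.ext fun m => ?_
  rw [MLoc.extHom_apply]
  rfl

theorem MLoc.extHom_extHom {U V W : Opens X} (h : U ≤ V) (h' : V ≤ W) (x : MLoc n F E U) :
    MLoc.extHom h' (MLoc.extHom h x) = MLoc.extHom (h.trans h') x := by
  refine DFinsupp.ext fun m => ?_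
  rw [MLoc.extHom_apply, MLoc.extHom_apply, MLoc.extHom_apply]
  rfl

variable (n F E) in
/-- The structure maps: products of extensions. -/
def MLoc.str {ι : Type} [Finite ι] (U : ι → Opens X) (V : Opens X) (hV : ∀ i, U i ≤ V) :
    MultilinearMap ℝ (fun i => MLoc n F E (U i)) (MLoc n F E V) :=
  let _ := Fintype.ofFinite ι
  (MultilinearMap.mkPiAlgebra ℝ ι (MLoc n F E V)).compLinearMap
    fun i => (MLoc.extHom (hV i)).toLinearMap

theorem MLoc.str_apply {ι : Type} [Fintype ι] (U : ι → Opens X) (V : Opens X)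
    (hV : ∀ i, U i ≤ V) (a : ∀ i, MLoc n F E (U i)) :
    MLoc.str n F E U V hV a = ∏ i, MLoc.extHom (hV i) (a i) := by
  change @Finset.prod _ _ _ (@Finset.univ ι (Fintype.ofFinite ι)) _ = _
  congr!

variable (n F E) in
/-- The prefactorization algebra of multilocal functionals. -/
def multilocalAlgebra : PrefactorizationAlgebra fun U : Opens X => MLoc n F E U where
  str U V _ hV := MLoc.str n F E U V hV
  str_id U _ a := by
    rw [MLoc.str_apply, Fintype.prod_unique, MLoc.extHom_self]
  str_reindex {ι κ} _ _ e U V hd hd' hV a := by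
    let _ := Fintype.ofFinite ι
    let _ := Fintype.ofFinite κ
    rw [MLoc.str_apply, MLoc.str_apply]
    exact e.prod_comp fun i => MLoc.extHom (hV i) (a i)
  str_assoc {ι κ} _ _ U W V hU hUW hW hWV hd a := by
    let _ := Fintype.ofFinite ι
    let _ := fun i => Fintype.ofFinite (κ i)
    rw [MLoc.str_apply, MLoc.str_apply, Fintype.prod_sigma]
    refine Finset.prod_congr rfl fun i _ => ?_
    rw [MLoc.str_apply, map_prod]
    exact Finset.prod_congr rfl fun j _ => MLoc.extHom_extHom _ _ _

theorem multilocalAlgebra_ext {U V : Opens X} (h : U ≤ V) (a : MLoc n F E U) :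
    (multilocalAlgebra n F E).ext h a = MLoc.extHom h a := by
  refine (MLoc.str_apply (fun _ : Unit => U) V (fun _ => h) fun _ => a).trans ?_
  rw [Fintype.prod_unique]

/-- Transport between degrees that are equal but not definitionally so, such as sums over an
inserted index. -/
theorem MLoc.lof_eq_lof {V : Opens X} {a b : ℕ} (hab : a = b) {f : MultiLoc n F E a V}
    {g : MultiLoc n F E b V} (hfg : f.1 = g.1) :
    lof ℝ ℕ (fun m => MultiLoc n F E m V) a f = lof ℝ ℕ (fun m => MultiLoc n F E m V) b g := by
  subst hab
  rw [Subtype.ext hfg]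

theorem MLoc.exists_prod_lof {ι : Type*} (s : Finset ι) {V : Opens X} (d : ι → ℕ)
    (f : ∀ i, MultiLoc n F E (d i) V) :
    ∃ g : MultiLoc n F E (∑ i ∈ s, d i) V, g.1 = ∏ i ∈ s, (f i).1 ∧
      ∏ i ∈ s, lof ℝ ℕ (fun m => MultiLoc n F E m V) (d i) (f i) =
        lof ℝ ℕ (fun m => MultiLoc n F E m V) (∑ i ∈ s, d i) g := by
  classical
  induction s using Finset.induction_on with
  | empty => exact ⟨⟨1, one_mem_multiLoc_zero V⟩, by simp, by simp; rfl⟩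
  | insert a s ha ih =>
    obtain ⟨g, hg, hgs⟩ := ih
    have hd : d a + ∑ i ∈ s, d i = ∑ i ∈ insert a s, d i := (Finset.sum_insert ha).symm
    have hmem : (f a).1 * g.1 ∈ MultiLoc n F E (∑ i ∈ insert a s, d i) V :=
      hd ▸ mul_mem_multiLoc (f a).2 g.2
    refine ⟨⟨_, hmem⟩, (congrArg ((f a).1 * ·) hg).trans (Finset.prod_insert (f := fun i => (f i).1) ha).symm, ?_⟩
    rw [Finset.prod_insert ha, hgs]
    refine (of_mul_of (A := fun m : ℕ => MultiLoc n F E m V) (f a) g).trans ?_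
    exact MLoc.lof_eq_lof hd rfl

theorem isProductStructure_multilocalAlgebra :
    IsProductStructure (multilocalAlgebra n F E) := by
  intro ι _ U V hd hV d f
  obtain ⟨g, hg, hgs⟩ := MLoc.exists_prod_lof Finset.univ d fun i => MultiLoc.ext (d i) (hV i) (f i)
  refine ⟨g, fun φ => ?_, ?_⟩
  · rw [hg, Finset.prod_apply]
    rfl
  · refine (MLoc.str_apply U V hV _).trans (Eq.trans ?_ hgs)
    exact Finset.prod_congr rfl fun i _ => MLoc.extHom_lof _ _ _

theorem sum_of_apply_eq {ι : Type*} [DecidableEq ι] {B : ι → Type*} [∀ i, AddCommGroup (B i)]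
    (x : ⨁ i, B i) (s : Finset ι) (hs : ∀ i ∉ s, x i = 0) : ∑ i ∈ s, of B i (x i) = x := by
  classical
  conv_rhs => rw [← sum_support_of x]
  refine (Finset.sum_subset (fun i hi => ?_) fun i _ hi => ?_).symm
  · by_contra h
    exact (DFinsupp.mem_support_iff.1 hi) (hs i h)
  · rw [DFinsupp.notMem_support_iff.1 hi, map_zero]

/-! ### From a fixed degree to the direct sum -/

section Exactness

variable {ι : Type w} {U : ι → Opens X} {V : Opens X}

theorem sumExt_surjective (hU : IsWeissCover U V) :
    Function.Surjective ((multilocalAlgebra n F E).sumExt U V hU.1) := by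
  classical
  rw [← LinearMap.range_eq_top, eq_top_iff]
  intro x _
  induction x using DirectSum.induction_on with
  | zero => exact zero_mem _
  | of m f =>
    refine hU.mem_of_forall_ext_mem ((LinearMap.range ((multilocalAlgebra n F E).sumExt U V
      hU.1)).comap (lof ℝ ℕ (fun m => MultiLoc n F E m V) m)) (fun i g => ?_) f
    exact ⟨_, ((multilocalAlgebra n F E).sumExt_lof hU.1 i
      (lof ℝ ℕ (fun m => MultiLoc n F E m (U i)) m g)).trans
      ((multilocalAlgebra_ext _ _).trans (MLoc.extHom_lof _ _ _))⟩
  | add x y hx hy => exact add_mem (hx trivial) (hy trivial)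

theorem sum_extCocone_eq_zero (hU : IsWeissCover U V) {Q : Type*} [AddCommGroup Q] [Module ℝ Q]
    (r : ∀ i, MLoc n F E (U i) →ₗ[ℝ] Q)
    (hr : ∀ i j (x : MLoc n F E (U i ⊓ U j)),
      r i (MLoc.extHom inf_le_left x) = r j (MLoc.extHom inf_le_right x))
    (s : Finset ι) (y : ∀ i, MLoc n F E (U i)) (hy : ∑ i ∈ s, MLoc.extHom (hU.1 i) (y i) = 0) :
    ∑ i ∈ s, r i (y i) = 0 := by
  classical
  -- Finitely many degrees occur in the whole family, so the relation splits into its homogeneous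
  -- components.
  let M : Finset ℕ := s.biUnion fun i => DFinsupp.support (y i)
  have hyM : ∀ i ∈ s, r i (y i) =
      ∑ m ∈ M, (r i ∘ₗ lof ℝ ℕ (fun m => MultiLoc n F E m (U i)) m) (y i m) := by
    intro i hi
    have h : ∑ m ∈ M, lof ℝ ℕ (fun m => MultiLoc n F E m (U i)) m (y i m) = y i := by
      refine sum_of_apply_eq (y i) M fun m hm => ?_
      by_contra h
      exact hm (Finset.mem_biUnion.2 ⟨i, hi, DFinsupp.mem_support_iff.2 h⟩)
    conv_lhs => rw [← h, map_sum]
    rfl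
  rw [Finset.sum_congr rfl hyM, Finset.sum_comm]
  refine Finset.sum_eq_zero fun m _ => ?_
  refine hU.sum_cocone_eq_zero (r := fun i => r i ∘ₗ lof ℝ ℕ (fun m => MultiLoc n F E m (U i)) m)
    (fun i j f => ?_) s (fun i => y i m) ?_
  · have h := hr i j (lof ℝ ℕ (fun m => MultiLoc n F E m (U i ⊓ U j)) m f)
    rwa [MLoc.extHom_lof, MLoc.extHom_lof] at h
  · refine Eq.trans ?_ (congrArg (fun z : MLoc n F E V => z m) hy)
    refine Eq.trans ?_ (DFinsupp.finsetSum_apply s (fun i => MLoc.extHom (hU.1 i) (y i)) m).symm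
    exact Finset.sum_congr rfl fun i _ => (MLoc.extHom_apply (hU.1 i) (y i) m).symm

theorem isFactorizationAlgebra_multilocalAlgebra :
    PrefactorizationAlgebra.IsFactorizationAlgebra.{w} (multilocalAlgebra n F E (X := X)) := by
  refine fun ι U V hU => ⟨(multilocalAlgebra n F E).exact_overlapDiff_sumExt hU.1
    (fun i j x => ?_) fun Q _ _ r hr s y hy => ?_, sumExt_surjective hU⟩
  · simp only [multilocalAlgebra_ext, MLoc.extHom_extHom]
  · refine sum_extCocone_eq_zero hU r (fun i j x => ?_) s y ?_
    · simpa only [multilocalAlgebra_ext] using hr i j x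
    · simpa only [multilocalAlgebra_ext] using hy

end Exactness

end FactorizationAlgebra

end

end Multilocal

theorem mainTheorem5 {n : ℕ} {X : Type*} [TopologicalSpace X] [T2Space X]
    [SecondCountableTopology X] [ChartedSpace (EuclideanSpace ℝ (Fin n)) X] [IsManifold (𝓡 n) ∞ X]
    [MeasurableSpace X] [BorelSpace X]
    {F : Type*} [NormedAddCommGroup F] [NormedSpace ℝ F] [FiniteDimensional ℝ F]
    (E : X → Type*) [∀ x, AddCommGroup (E x)] [∀ x, Module ℝ (E x)]
    [∀ x, TopologicalSpace (E x)] [TopologicalSpace (TotalSpace F E)] [FiberBundle F E]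
    [VectorBundle ℝ F E] [ContMDiffVectorBundle ∞ F E (𝓡 n)] :
    ∃ P : Multilocal.PrefactorizationAlgebra fun U : Opens X => Multilocal.MLoc n F E U,
      Multilocal.IsProductStructure P ∧
        Multilocal.PrefactorizationAlgebra.IsFactorizationAlgebra.{w} P :=
  ⟨Multilocal.multilocalAlgebra n F E, Multilocal.isProductStructure_multilocalAlgebra,
    Multilocal.isFactorizationAlgebra_multilocalAlgebra⟩
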